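/- **Setting.** For $x\in\mathbb R$ let $\operatorname{sign}(x)\in\{-1,1\}$ (the value at $0$ is irrelevant up to null events). For each $n$ let $\rho=\rho_n$ and let $\nu_t(j),\psi_t(i,j)$ ($t\ge 1$, $1\le i,j\le n$) be independent standard Gaussians. Put $\theta_t(i,j)=\sqrt{\rho}\,\nu_t(j)+\sqrt{1-\rho}\,\psi_t(i,j)$, so that $\theta_1,\theta_2,\dots$ are independent $n\times n$ matrices with independent columns, each column being a centred Gaussian vector with unit variances and all pairwise correlations $\rho$. For $\omega\in\{-1,1\}^n$ let $\omega_0=\omega$, $\omega_t=\operatorname{sign}(\theta_t\omega_{t-1})$ (coordinatewise), and for Boolean $h_n:\{-1,1\}^n\to\{-1,1\}$ let $f_{n,T}(\omega)=h_n(\omega_T)$; this is a random Boolean function, through the weights. Let $\omega$ be uniform on $\{-1,1\}^n$, and let $\omega^{\epsilon}$ be obtained from $\omega$ by flipping each bit independently with probability $\epsilon$, with $(\omega,\omega^\epsilon)$ independent of the weights. Let $C_t\subseteq\{1,\dots,n\}$ be the set of positions where $\omega_t$ and $(\omega^\epsilon)_t$ differ, $D_t=|C_t|$ and $\tilde D_t=D_t/n$.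 For $w=(w_1,w_2)$ and $v\in[0,1]$ let $g_w(v)=\mathrm P\big(\sqrt{1-v}\,|Y|\le\sqrt{v}\,|X|\big)$, where $X\sim N(w_1,1)$ and $Y\sim N(w_2,1)$ are independent. With $d=D_{t-1}$ let $$W_t=\sqrt{\tfrac{\rho}{1-\rho}}\Big(\tfrac1{\sqrt d}\sum_{j\in C_{t-1}}\omega_{t-1}(j)\nu_t(j),\ \tfrac1{\sqrt{n-d}}\sum_{j\notin C_{t-1}}\omega_{t-1}(j)\nu_t(j)\Big)$$ (if $d\in\{0,n\}$ the coordinate with an empty sum is immaterial). Then, given the past and $W_t=w$, $\tilde D_{t-1}=v$, the variable $D_t$ is binomial with parameters $n$ and $g_w(v)$. Let $\tau^{\epsilon}_{1/2}=\min\{t\ge1: g_{W_t}(\tilde D_{t-1})\ge \tfrac12\}$, with $\tau^{\epsilon}_{1/2}=\infty$ if there is no such $t$. **Notions.** The random functions $f_n$ are *annealed QNS at level $\{\epsilon_n\}$* if $\mathrm{Cov}(f_n(\omega),f_n(\omega^{\epsilon_n}))\to0$, the covariance being over $f_n,\omega,\omega^{\epsilon_n}$ jointly. They are *quenched QNS at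 level $\{\epsilon_n\}$* if for every $\delta'>0$, for all large $n$, with probability at least $1-\delta'$ over $f_n$ one has $\mathrm{Cov}_{\omega,\omega^{\epsilon_n}}(f_n(\omega),f_n(\omega^{\epsilon_n}))\le\delta'$. The sequence $\{h_n\}$ *has a sharp threshold at $1/2$* if for every $p_n\in[0,1]$ with $|p_n-\frac12|$ bounded away from $0$, and $\omega$ with i.i.d. bits equal to $1$ with probability $p_n$ and to $-1$ otherwise, $\mathrm P(h_n(\omega)=\operatorname{sign}(p_n-\frac12))\to1$. The function $h_n$ is odd if $h_n(-\omega)=-h_n(\omega)$ for all $\omega$. **Theorem.** There are integers $K_n$, depending only on $n$, such that the following holds. Let $\frac12\ge\epsilon_n$ be non-increasing with $\epsilon_n\to0$ and $n\epsilon_n\to\infty$. Let $\delta>0$ be independent of $n$, and assume that for all sufficiently large $n$ $$\delta<\rho_n<1-\frac{4(\log\log n)^3}{\log n},\qquad T_n\ge e^{4(\log\log n)^2}.$$ Then: (i) $\lim_{n\to\infty}\mathrm P\big(\tau^{\epsilon_n}_{1/2}>T_n\big)=0$. (ii) If $h_n$ is odd for all large $n$ and $\{h_n\}$ has a sharp threshold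 at $1/2$, then $\{f_{n,T_n}\}$ is annealed QNS and quenched QNS at level $\{\epsilon_n\}$. (iii) If $h_n$ is odd for all large $n$ and $T_n\ge K_n$ for all large $n$, then $\{f_{n,T_n}\}$ is annealed QNS and quenched QNS at level $\{\epsilon_n\}$. -/

import Mathlib

open MeasureTheory ProbabilityTheory Filter Topology

noncomputable section

/-- The Boolean cube `{-1, 1}^n`; `ℤˣ` is the two-point set `{1, -1}`. -/
abbrev Cube (n : ℕ) : Type := Fin n → ℤˣ

/-- The set of Boolean functions `{-1, 1}^n → {-1, 1}`. -/
abbrev BoolFun (n : ℕ) : Type := Cube n → ℤˣ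

/-- The real number `1` or `-1` given by a sign. -/
def signVal (u : ℤˣ) : ℝ := ((u : ℤ) : ℝ)

/-- The sign of a real number (the value at `0` only matters on a null event). -/
def realSign (x : ℝ) : ℤˣ := if 0 < x then 1 else -1

instance instMeasurableSingletonClassSigns : MeasurableSingletonClass ℤˣ :=
  ⟨fun u => ⟨{(u : ℤ)}, measurableSet_singleton _, by ext x; simp [Units.ext_iff]⟩⟩

/-! ### Uniform input, noise, and noise sensitivity -/

/-- The law on `{-1, 1}` giving mass `p` to `1` and mass `1 - p` to `-1`, for `0 ≤ p ≤ 1`. -/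
def signBernoulli (p : ℝ) : Measure ℤˣ :=
  ENNReal.ofReal p • Measure.dirac 1 + ENNReal.ofReal (1 - p) • Measure.dirac (-1)

/-- The law of `n` i.i.d. signs that are `1` with probability `p`. -/
def cubeBernoulli (n : ℕ) (p : ℝ) : Measure (Cube n) :=
  Measure.pi fun _ => signBernoulli p

/-- The joint law of `(ω, ω^ε)`: `ω` is uniform on the cube, and each bit of `ω` is flipped
independently with probability `ε` (the factor `x.2` is `-1` exactly at the flipped bits). -/
def noisyPair (n : ℕ) (ε : ℝ) : Measure (Cube n × Cube n) :=
  ((cubeBernoulli n (1 / 2)).prod (cubeBernoulli n (1 - ε))).map fun x => (x.1, x.1 * x.2)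

/-- A sequence `π n` of laws of random Boolean functions is annealed QNS at level `ε`: the
covariance of `f(ω)` and `f(ω^ε)`, over `f`, `ω` and `ω^ε` jointly, tends to `0`. -/
def AnnealedQNS (π : (n : ℕ) → Measure (BoolFun n)) (ε : ℕ → ℝ) : Prop :=
  Tendsto (fun n => covariance (fun x : BoolFun n × (Cube n × Cube n) => signVal (x.1 x.2.1))
    (fun x => signVal (x.1 x.2.2)) ((π n).prod (noisyPair n (ε n)))) atTop (𝓝 0)

/-- A sequence `π n` of laws of random Boolean functions is quenched QNS at level `ε`. -/
def QuenchedQNS (π : (n : ℕ) → Measure (BoolFun n)) (ε : ℕ → ℝ) : Prop :=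
  ∀ δ : ℝ, 0 < δ → ∃ N : ℕ, ∀ n ≥ N,
    1 - δ ≤ (π n).real {f | covariance (fun x : Cube n × Cube n => signVal (f x.1))
      (fun x => signVal (f x.2)) (noisyPair n (ε n)) ≤ δ}

/-- Sharp threshold at `1/2`: if `p n - 1/2` is bounded away from `0` and the bits are i.i.d. and
equal to `1` with probability `p n`, then `h n` equals the sign of `p n - 1/2` with probability
tending to `1`. -/
def SharpThresholdAtHalf (h : (n : ℕ) → BoolFun n) : Prop :=
  ∀ p : ℕ → ℝ, (∀ n, 0 ≤ p n ∧ p n ≤ 1) → (∃ c : ℝ, 0 < c ∧ ∀ n, c ≤ |p n - 1 / 2|) →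
    Tendsto (fun n => (cubeBernoulli n (p n)).real {ω | h n ω = realSign (p n - 1 / 2)})
      atTop (𝓝 1)

/-! ### The network with correlated weights -/

/-- The Gaussian variables behind one layer: the vector `(ν(j))` shared by all rows, and the
matrix `(ψ(i,j))`. -/
abbrev Layer (n : ℕ) : Type := (Fin n → ℝ) × (Fin n → Fin n → ℝ)

/-- All `ν(j)` and `ψ(i,j)` are independent standard Gaussians. -/
def layerLaw (n : ℕ) : Measure (Layer n) :=
  (Measure.pi fun _ => gaussianReal 0 1).prod
    (Measure.pi fun _ => Measure.pi fun _ => gaussianReal 0 1)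

/-- The layers are i.i.d. -/
def networkLaw (n : ℕ) : Measure (ℕ → Layer n) := Measure.infinitePi fun _ => layerLaw n

instance instIsProbabilityMeasureLayerLaw (n : ℕ) : IsProbabilityMeasure (layerLaw n) := by
  unfold layerLaw; infer_instance

instance instIsProbabilityMeasureNetworkLaw (n : ℕ) : IsProbabilityMeasure (networkLaw n) := by
  unfold networkLaw; infer_instance

/-- The weight matrix `θ(i,j) = √ρ ν(j) + √(1-ρ) ψ(i,j)` of a layer. For `0 ≤ ρ ≤ 1` its columns
are independent centred Gaussian vectors with unit variances and all correlations equal to `ρ`. -/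
def weight {n : ℕ} (ρ : ℝ) (L : Layer n) : Matrix (Fin n) (Fin n) ℝ :=
  Matrix.of fun i j => √ρ * L.1 j + √(1 - ρ) * L.2 i j

/-- `ω_t`, where `ω_0 = ω` and `ω_{t+1} = sign(θ_{t+1} ω_t)`. The layer that leads from `ω_t` to
`ω_{t+1}` is `Θ t` (so `Θ 0` is the first layer). -/
def state {n : ℕ} (ρ : ℝ) (Θ : ℕ → Layer n) (ω : Cube n) : ℕ → Cube n
  | 0 => ω
  | t + 1 => fun i =>
      realSign ((weight ρ (Θ t)).mulVec (fun j => signVal (state ρ Θ ω t j)) i)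

/-- The Boolean function `f_{n,T}(ω) = h(ω_T)`. -/
def network {n : ℕ} (ρ : ℝ) (T : ℕ) (h : BoolFun n) (Θ : ℕ → Layer n) : BoolFun n :=
  fun ω => h (state ρ Θ ω T)

theorem measurable_realSign : Measurable realSign :=
  Measurable.ite measurableSet_Ioi measurable_const measurable_const

theorem measurable_state {n : ℕ} (ρ : ℝ) (ω : Cube n) (t : ℕ) :
    Measurable fun Θ : ℕ → Layer n => state ρ Θ ω t := by
  induction t with
  | zero => exact measurable_const
  | succ t ih =>
    refine measurable_pi_lambda _ fun i => measurable_realSign.comp ?_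
    simp only [Matrix.mulVec, dotProduct, weight, Matrix.of_apply]
    refine Finset.measurable_sum _ fun j _ => ?_
    refine Measurable.mul (by fun_prop) ?_
    exact (measurable_of_countable signVal).comp ((measurable_pi_apply j).comp ih)

/-- The random Boolean function is measurable in the weights, so its law below is a genuine
push-forward. -/
theorem measurable_network {n : ℕ} (ρ : ℝ) (T : ℕ) (h : BoolFun n) :
    Measurable (network ρ T h) :=
  measurable_pi_lambda _ fun ω => (measurable_of_countable h).comp (measurable_state ρ ω T)

/-- The law of the random Boolean function `f_{n,T}`. -/
def networkFunLaw (n : ℕ) (ρ : ℝ) (T : ℕ) (h : BoolFun n) : Measure (BoolFun n) :=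
  (networkLaw n).map (network ρ T h)

/-! ### The disagreement process -/

/-- The set of positions at which two inputs differ. -/
def disagree {n : ℕ} (x y : Cube n) : Finset (Fin n) := Finset.univ.filter fun j => x j ≠ y j

/-- The proportion of positions at which two inputs differ. -/
def disagreeFrac {n : ℕ} (x y : Cube n) : ℝ := ((disagree x y).card : ℝ) / n

/-- `g_w(v) = P(|Y| ≤ √(v/(1-v)) |X|)` for independent `X ~ N(w₁, 1)`, `Y ~ N(w₂, 1)`. The
inequality is multiplied by `√(1-v)`, so that `g_w(1) = 1`. -/
def gProb (w : ℝ × ℝ) (v : ℝ) : ℝ :=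
  ((gaussianReal w.1 1).prod (gaussianReal w.2 1)).real {p | √(1 - v) * |p.2| ≤ √v * |p.1|}

/-- `W = √(ρ/(1-ρ)) (U^C, U^{Cᶜ})`, where `C` is the set of the `d` positions at which `x` and `y`
differ, `√d U^C = ∑_{j ∈ C} x(j) ν(j)` and `√(n-d) U^{Cᶜ} = ∑_{j ∉ C} x(j) ν(j)`. If `d = 0` or
`d = n`, one of the two coordinates is immaterial, as `g_w(0) = 0` and `g_w(1) = 1` for all `w`. -/
def wVec {n : ℕ} (ρ : ℝ) (ν : Fin n → ℝ) (x y : Cube n) : ℝ × ℝ :=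
  (√(ρ / (1 - ρ)) * ((∑ j ∈ disagree x y, signVal (x j) * ν j) / √((disagree x y).card : ℝ)),
   √(ρ / (1 - ρ)) *
    ((∑ j ∈ (disagree x y)ᶜ, signVal (x j) * ν j) / √((n : ℝ) - (disagree x y).card)))

/-- `τ_c = min {t ≥ 1 : g_{W_t}(D_{t-1} / n) ≥ c}` (and `∞` if there is no such `t`) for the
network started from the two inputs `x` and `y`. Here `t = s + 1`, and the shared Gaussian vector
of layer `t` is `(Θ s).1`. -/
def hitTime {n : ℕ} (ρ c : ℝ) (Θ : ℕ → Layer n) (x y : Cube n) : ℕ∞ :=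
  ⨅ (s : ℕ) (_ : c ≤ gProb (wVec ρ (Θ s).1 (state ρ Θ x s) (state ρ Θ y s))
    (disagreeFrac (state ρ Θ x s) (state ρ Θ y s))), ((s + 1 : ℕ) : ℕ∞)

end

noncomputable section

/-! ### Signs and the noise operator -/

/-! Given the shared vector of a layer, the coordinatewise products of the two next states are
i.i.d. signs, equal to `-1` with probability g (`map_step_mul_step`). Everything rests on two
symmetries and one growth estimate.

Correlation. The weight law is invariant under sign changes of columns, so the expected product of
the outputs after at least one further layer depends on the two inputs only through their product
(`outputCorr_mul_left`). The pair produced by a layer may thus be replaced by a noisy pair at noise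
level g. For any Boolean function the correlation under noise at most 1/2 is a nonnegative
combination of squared Fourier coefficients (`noiseCorr_nonneg`); for an odd function, replacing the
noise level by its complement changes the sign. Hence from a layer with g ≥ 1/2 on, the expected
correlation is at most 0, and overall it is at most the probability that no such layer occurs
(`outputCorr_succ_le_survProb`). As the quenched correlation is also nonnegative, the annealed
statement is a squeeze and the quenched one is Markov's inequality.

Survival. Put L = log log n and R = ρ/(1-ρ). The two coordinates of W are independent N(0, R)
variables. With probability at least of order 1/√(log n), |W₁| is large and |W₂| ≤ 1; then either g
≥ 1/2 or g ≥ 4√v, and in the latter case the disagreement fraction passes from v to at least √v with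
probability at least 1/2. Starting from v ≥ 1/n, about log₂ log n such steps suffice, so a block of
at most 2L layers succeeds with probability at least b = exp(-2L²) (`survProb_le_of_disagreeFrac`).
Two distinct states merge without a hit in one layer with probability at most η = 3 exp(-L³/2),
since typically n g is at least of order n^(1/4) (`killOp_diagInd_le`). Iterating over blocks of
length k gives (1-b)^j + kη/b (`survProb_blocks_le`), in which the merging cost does not grow with
the depth. The inputs coincide initially with probability (1-ε)^n, which tends to 0. -/

@[simp] theorem signVal_one : signVal 1 = 1 := by simp [signVal]

@[simp] theorem signVal_neg_one : signVal (-1) = -1 := by simp [signVal]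

@[simp] theorem signVal_neg (u : ℤˣ) : signVal (-u) = -signVal u := by simp [signVal]

theorem signVal_mul (u v : ℤˣ) : signVal (u * v) = signVal u * signVal v := by simp [signVal]

theorem signVal_mul_self (u : ℤˣ) : signVal u * signVal u = 1 := by
  rcases Int.units_eq_one_or u with rfl | rfl <;> simp

theorem abs_signVal (u : ℤˣ) : |signVal u| = 1 := by
  rcases Int.units_eq_one_or u with rfl | rfl <;> simp

theorem isProbabilityMeasure_signBernoulli {p : ℝ} (h0 : 0 ≤ p) (h1 : p ≤ 1) :
    IsProbabilityMeasure (signBernoulli p) := by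
  refine ⟨?_⟩
  simp only [signBernoulli, Measure.add_apply, Measure.smul_apply, measure_univ, smul_eq_mul,
    mul_one]
  rw [← ENNReal.ofReal_add h0 (by linarith)]
  simp

theorem isProbabilityMeasure_cubeBernoulli (n : ℕ) {p : ℝ} (h0 : 0 ≤ p) (h1 : p ≤ 1) :
    IsProbabilityMeasure (cubeBernoulli n p) := by
  have := isProbabilityMeasure_signBernoulli h0 h1
  unfold cubeBernoulli
  infer_instance

theorem isProbabilityMeasure_noisyPair (n : ℕ) {ε : ℝ} (h0 : 0 ≤ ε) (h1 : ε ≤ 1) :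
    IsProbabilityMeasure (noisyPair n ε) := by
  have := isProbabilityMeasure_cubeBernoulli n (p := 1 / 2) (by norm_num) (by norm_num)
  have := isProbabilityMeasure_cubeBernoulli n (p := 1 - ε) (by linarith) (by linarith)
  exact Measure.isProbabilityMeasure_map (measurable_of_countable _).aemeasurable

/-- The form affine in the sign turns the noise kernel into a product of factors 1 + (1-2ε)x(i)y(i),
which expands in characters. -/
theorem signBernoulli_real_singleton {p : ℝ} (h0 : 0 ≤ p) (h1 : p ≤ 1) (u : ℤˣ) :
    (signBernoulli p).real {u} = (1 + (2 * p - 1) * signVal u) / 2 := by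
  rcases Int.units_eq_one_or u with rfl | rfl
  · simp [signBernoulli, Measure.real, h0]
  · have : (1 : ℤˣ) ≠ -1 := by decide
    simp [signBernoulli, Measure.real, h1, this]
    ring

theorem eq_signBernoulli {μ : Measure ℤˣ} [IsProbabilityMeasure μ] :
    μ = signBernoulli (1 - μ.real {-1}) := by
  have hle : μ.real {-1} ≤ 1 := measureReal_le_one
  have := isProbabilityMeasure_signBernoulli (p := 1 - μ.real {-1}) (by linarith)
    (by linarith [measureReal_nonneg (μ := μ) (s := {-1})])
  have hneg : μ.real {-1} = (signBernoulli (1 - μ.real {-1})).real {-1} := by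
    rw [signBernoulli_real_singleton (by linarith)
      (by linarith [measureReal_nonneg (μ := μ) (s := {-1})])]
    simp
    ring
  have hc : ({1} : Set ℤˣ) = {-1}ᶜ := by
    ext u
    rcases Int.units_eq_one_or u with rfl | rfl <;> decide
  refine Measure.ext_of_singleton fun u => ?_
  rw [← measureReal_eq_measureReal_iff]
  rcases Int.units_eq_one_or u with rfl | rfl
  · rw [hc, probReal_compl_eq_one_sub (measurableSet_singleton _),
      probReal_compl_eq_one_sub (measurableSet_singleton _), ← hneg]
  · exact hneg

theorem cubeBernoulli_real_singleton {n : ℕ} {p : ℝ} (h0 : 0 ≤ p) (h1 : p ≤ 1) (z : Cube n) :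
    (cubeBernoulli n p).real {z} = ∏ i, ((1 + (2 * p - 1) * signVal (z i)) / 2) := by
  have := isProbabilityMeasure_signBernoulli h0 h1
  rw [cubeBernoulli, Measure.real, Measure.pi_singleton, ENNReal.toReal_prod]
  exact Finset.prod_congr rfl fun i _ => signBernoulli_real_singleton h0 h1 _

theorem integral_cubeBernoulli {n : ℕ} {p : ℝ} (h0 : 0 ≤ p) (h1 : p ≤ 1) (G : Cube n → ℝ) :
    ∫ z, G z ∂cubeBernoulli n p =
      ∑ z, (∏ i, ((1 + (2 * p - 1) * signVal (z i)) / 2)) * G z := by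
  have := isProbabilityMeasure_cubeBernoulli n h0 h1
  rw [integral_fintype (Integrable.of_finite)]
  exact Finset.sum_congr rfl fun z _ => by rw [cubeBernoulli_real_singleton h0 h1, smul_eq_mul]

theorem integral_cubeBernoulli_half {n : ℕ} (G : Cube n → ℝ) :
    ∫ z, G z ∂cubeBernoulli n (1 / 2) = (1 / 2) ^ n * ∑ z, G z := by
  rw [integral_cubeBernoulli (by norm_num) (by norm_num), Finset.mul_sum]
  simp

theorem integral_noisyPair {n : ℕ} {ε : ℝ} (h0 : 0 ≤ ε) (h1 : ε ≤ 1)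
    (G : Cube n × Cube n → ℝ) :
    ∫ p, G p ∂noisyPair n ε =
      ∫ z, ∫ x, G (x, x * z) ∂cubeBernoulli n (1 / 2) ∂cubeBernoulli n (1 - ε) := by
  have := isProbabilityMeasure_cubeBernoulli n (p := 1 / 2) (by norm_num) (by norm_num)
  have := isProbabilityMeasure_cubeBernoulli n (p := 1 - ε) (by linarith) (by linarith)
  rw [noisyPair, integral_map (measurable_of_countable _).aemeasurable
    (measurable_of_countable _).aestronglyMeasurable, integral_prod_symm _ Integrable.of_finite]

theorem integral_noisyPair_eq_sum {n : ℕ} {ε : ℝ} (h0 : 0 ≤ ε) (h1 : ε ≤ 1)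
    (G : Cube n × Cube n → ℝ) :
    ∫ p, G p ∂noisyPair n ε =
      (1 / 4) ^ n * ∑ x, ∑ y, (∏ i, (1 + (1 - 2 * ε) * (signVal (x i) * signVal (y i)))) *
        G (x, y) := by
  rw [integral_noisyPair h0 h1, integral_cubeBernoulli (by linarith) (by linarith)]
  simp only [integral_cubeBernoulli_half, Finset.mul_sum]
  rw [Finset.sum_comm]
  refine Finset.sum_congr rfl fun x _ => ?_
  refine Fintype.sum_equiv (Equiv.mulLeft x) _ _ fun z => ?_
  have hz : ∀ i, signVal (x i) * signVal ((x * z) i) = signVal (z i) := fun i => by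
    rw [Pi.mul_apply, signVal_mul, ← mul_assoc, signVal_mul_self, one_mul]
  simp only [Equiv.coe_mulLeft, hz, Finset.prod_div_distrib, Finset.prod_const, Finset.card_univ,
    Fintype.card_fin]
  rw [show (1 / 4 : ℝ) = 1 / 2 * (1 / 2) by norm_num, mul_pow,
    show 2 * (1 - ε) - 1 = 1 - 2 * ε by ring]
  field_simp
  rw [mul_assoc _ ((2 : ℝ) ^ n), ← mul_pow]
  norm_num

/-- The correlation of `f(ω)` and `f(ω^ε)`. -/
def noiseCorr {n : ℕ} (ε : ℝ) (f : BoolFun n) : ℝ :=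
  ∫ p, signVal (f p.1) * signVal (f p.2) ∂noisyPair n ε

/-- Expanding the kernel over subsets S of coordinates gives, up to normalisation, the sum of
(1-2ε)^|S| times squared Fourier coefficients; ε ≤ 1/2 makes every weight nonnegative. -/
theorem noiseCorr_nonneg {n : ℕ} {ε : ℝ} (h0 : 0 ≤ ε) (h1 : ε ≤ 1 / 2) (f : BoolFun n) :
    0 ≤ noiseCorr ε f := by
  rw [noiseCorr, integral_noisyPair_eq_sum h0 (by linarith)]
  refine mul_nonneg (by positivity) ?_
  have key : ∀ x y : Cube n,
      (∏ i, (1 + (1 - 2 * ε) * (signVal (x i) * signVal (y i)))) *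
        (signVal (f x) * signVal (f y)) =
      ∑ s : Finset (Fin n), (1 - 2 * ε) ^ s.card * ((signVal (f x) * ∏ i ∈ s, signVal (x i)) *
        (signVal (f y) * ∏ i ∈ s, signVal (y i))) := by
    intro x y
    rw [Finset.prod_one_add, Finset.powerset_univ, Finset.sum_mul]
    refine Finset.sum_congr rfl fun s _ => ?_
    rw [Finset.prod_mul_distrib, Finset.prod_mul_distrib, Finset.prod_const]
    ring
  simp only [key]
  have hcomm : ∑ x, ∑ y, ∑ s : Finset (Fin n), (1 - 2 * ε) ^ s.card *
        ((signVal (f x) * ∏ i ∈ s, signVal (x i)) * (signVal (f y) * ∏ i ∈ s, signVal (y i))) =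
      ∑ s : Finset (Fin n), (1 - 2 * ε) ^ s.card *
        (∑ x, signVal (f x) * ∏ i ∈ s, signVal (x i)) ^ 2 := by
    simp only [fun x => Finset.sum_comm (s := (Finset.univ : Finset (Cube n)))
      (t := (Finset.univ : Finset (Finset (Fin n))))
      (f := fun y s => (1 - 2 * ε) ^ s.card * ((signVal (f x) * ∏ i ∈ s, signVal (x i)) *
        (signVal (f y) * ∏ i ∈ s, signVal (y i))))]
    rw [Finset.sum_comm]
    refine Finset.sum_congr rfl fun s _ => ?_
    simp only [← Finset.mul_sum]
    rw [sq, Finset.sum_mul]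
  rw [hcomm]
  exact Finset.sum_nonneg fun s _ => mul_nonneg (pow_nonneg (by linarith) _) (sq_nonneg _)

/-- The substitution y ↦ -y exchanges the kernels at ε and 1-ε, and oddness contributes the sign. -/
theorem noiseCorr_one_sub {n : ℕ} {ε : ℝ} (h0 : 0 ≤ ε) (h1 : ε ≤ 1) {f : BoolFun n}
    (hf : Function.Odd f) : noiseCorr (1 - ε) f = -noiseCorr ε f := by
  rw [noiseCorr, noiseCorr, integral_noisyPair_eq_sum h0 h1,
    integral_noisyPair_eq_sum (by linarith) (by linarith), ← mul_neg, ← Finset.sum_neg_distrib]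
  congr 1
  refine Finset.sum_congr rfl fun x _ => ?_
  rw [← Finset.sum_neg_distrib]
  refine Fintype.sum_equiv (Equiv.neg _) _ _ fun y => ?_
  have hp : ∀ i, 1 + (1 - 2 * ε) * (signVal (x i) * signVal ((-y) i)) =
      1 + (1 - 2 * (1 - ε)) * (signVal (x i) * signVal (y i)) := fun i => by
    rw [Pi.neg_apply, signVal_neg]; ring
  simp only [Equiv.neg_apply, hp, hf y, signVal_neg]
  ring

theorem noiseCorr_nonpos {n : ℕ} {ε : ℝ} (h0 : 1 / 2 ≤ ε) (h1 : ε ≤ 1) {f : BoolFun n}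
    (hf : Function.Odd f) : noiseCorr ε f ≤ 0 := by
  have h := noiseCorr_nonneg (ε := 1 - ε) (by linarith) (by linarith) f
  rw [noiseCorr_one_sub (by linarith) h1 hf] at h
  linarith

theorem integral_signVal_of_odd {n : ℕ} {f : BoolFun n} (hf : Function.Odd f) :
    ∫ x, signVal (f x) ∂cubeBernoulli n (1 / 2) = 0 := by
  rw [integral_cubeBernoulli_half]
  have h : ∑ x : Cube n, signVal (f x) = ∑ x : Cube n, -signVal (f x) :=
    Fintype.sum_equiv (Equiv.neg _) _ _ fun x => by simp [hf x]
  rw [Finset.sum_neg_distrib] at h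
  rw [show ∑ x : Cube n, signVal (f x) = 0 by linarith, mul_zero]

theorem map_fst_noisyPair {n : ℕ} {ε : ℝ} (h0 : 0 ≤ ε) (h1 : ε ≤ 1) :
    (noisyPair n ε).map Prod.fst = cubeBernoulli n (1 / 2) := by
  have := isProbabilityMeasure_cubeBernoulli n (p := 1 / 2) (by norm_num) (by norm_num)
  have := isProbabilityMeasure_cubeBernoulli n (p := 1 - ε) (by linarith) (by linarith)
  rw [noisyPair, Measure.map_map measurable_fst (measurable_of_countable _)]
  exact measurePreserving_fst.map_eq

/-- The probability that noise leaves all bits unchanged. -/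
theorem noisyPair_real_diagonal {n : ℕ} {ε : ℝ} (h0 : 0 ≤ ε) (h1 : ε ≤ 1) :
    (noisyPair n ε).real {p | p.1 = p.2} = (1 - ε) ^ n := by
  have := isProbabilityMeasure_cubeBernoulli n (p := 1 / 2) (by norm_num) (by norm_num)
  have := isProbabilityMeasure_cubeBernoulli n (p := 1 - ε) (by linarith) (by linarith)
  rw [noisyPair, map_measureReal_apply (measurable_of_countable _) (Set.toFinite _).measurableSet]
  have : (fun x : Cube n × Cube n => (x.1, x.1 * x.2)) ⁻¹' {p | p.1 = p.2} =
      Set.univ ×ˢ {1} := by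
    ext x
    simp
  rw [this, measureReal_prod_prod, probReal_univ, one_mul,
    cubeBernoulli_real_singleton (by linarith) (by linarith)]
  simp

/-! ### Gaussian sums -/

/-- The law of `n` independent standard Gaussians. -/
def stdGaussianPi (n : ℕ) : Measure (Fin n → ℝ) := Measure.pi fun _ => gaussianReal 0 1

instance instIsProbabilityMeasureStdGaussianPi (n : ℕ) :
    IsProbabilityMeasure (stdGaussianPi n) := by
  unfold stdGaussianPi; infer_instance

/-- The signed sum `∑ j ∈ s, x(j) ν(j)`. -/
def signedSum {n : ℕ} (s : Finset (Fin n)) (x : Cube n) (ν : Fin n → ℝ) : ℝ :=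
  ∑ j ∈ s, signVal (x j) * ν j

@[fun_prop]
theorem measurable_signedSum {n : ℕ} (s : Finset (Fin n)) (x : Cube n) :
    Measurable (signedSum s x) := by
  unfold signedSum; fun_prop

theorem iIndepFun_signVal_mul {n : ℕ} (x : Cube n) :
    iIndepFun (fun j (ν : Fin n → ℝ) => signVal (x j) * ν j) (stdGaussianPi n) :=
  iIndepFun_pi (X := fun j r => signVal (x j) * r) fun j => by fun_prop

theorem map_signVal_mul_gaussianReal (u : ℤˣ) :
    (gaussianReal 0 1).map (fun r => signVal u * r) = gaussianReal 0 1 := by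
  rw [gaussianReal_map_const_mul]
  congr 1
  · simp
  · ext
    simp [sq, signVal_mul_self]

theorem map_signedSum {n : ℕ} (s : Finset (Fin n)) (x : Cube n) :
    (stdGaussianPi n).map (signedSum s x) = gaussianReal 0 s.card := by
  induction s using Finset.induction_on with
  | empty =>
    simp only [Finset.card_empty, Nat.cast_zero, gaussianReal_zero_var]
    have : signedSum (∅ : Finset (Fin n)) x = fun _ => 0 := by
      ext; simp [signedSum]
    rw [this, Measure.map_const, measure_univ, one_smul]
  | insert j s hj ih =>
    have hind : IndepFun (signedSum s x) (fun ν : Fin n → ℝ => signVal (x j) * ν j)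
        (stdGaussianPi n) := by
      have := (iIndepFun_signVal_mul x).indepFun_finsetSum_of_notMem
        (fun i => by fun_prop) hj
      convert this using 1
      ext ν
      simp [signedSum]
    have hj' : (stdGaussianPi n).map (fun ν : Fin n → ℝ => signVal (x j) * ν j) =
        gaussianReal 0 1 := by
      rw [← map_signVal_mul_gaussianReal (x j),
        ← (measurePreserving_eval (fun _ : Fin n => gaussianReal 0 1) j).map_eq,
        Measure.map_map (by fun_prop) (by fun_prop)]
      rfl
    have h := gaussianReal_add_gaussianReal_of_indepFun hind ih hj'
    rw [Finset.card_insert_of_notMem hj]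
    convert h using 2
    · ext ν
      simp [signedSum, Finset.sum_insert hj, add_comm]
    · simp
    · simp

theorem map_signedSum_prod {n : ℕ} (s : Finset (Fin n)) (x : Cube n) :
    (stdGaussianPi n).map (fun ν => (signedSum s x ν, signedSum sᶜ x ν)) =
      (gaussianReal 0 s.card).prod (gaussianReal 0 sᶜ.card) := by
  have hind : IndepFun (signedSum s x) (signedSum sᶜ x) (stdGaussianPi n) := by
    have h := (iIndepFun_signVal_mul x).indepFun_finset s sᶜ disjoint_compl_right
      (fun i => by fun_prop)
    have h2 := h.comp (φ := fun v => ∑ i, v i) (ψ := fun v => ∑ i, v i) (by fun_prop)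
      (by fun_prop)
    convert h2 using 1
    · ext ν; simp only [signedSum, Function.comp]
      exact (Finset.sum_coe_sort s fun i => signVal (x i) * ν i).symm
    · ext ν; simp only [signedSum, Function.comp]
      exact (Finset.sum_coe_sort sᶜ fun i => signVal (x i) * ν i).symm
  rw [(indepFun_iff_map_prod_eq_prod_map_map (by fun_prop) (by fun_prop)).1 hind,
    map_signedSum, map_signedSum]

/-! ### One layer -/

/-- The input of the sign function in a row with shared vector `ν` and private vector `r`. -/
def preact {n : ℕ} (ρ : ℝ) (ν r : Fin n → ℝ) (x : Cube n) : ℝ :=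
  √ρ * signedSum Finset.univ x ν + √(1 - ρ) * signedSum Finset.univ x r

/-- One step of the network. -/
def step {n : ℕ} (ρ : ℝ) (L : Layer n) (x : Cube n) : Cube n :=
  fun i => realSign (preact ρ L.1 (L.2 i) x)

theorem state_succ {n : ℕ} (ρ : ℝ) (Θ : ℕ → Layer n) (x : Cube n) (t : ℕ) :
    state ρ Θ x (t + 1) = step ρ (Θ t) (state ρ Θ x t) := by
  ext1 i
  simp only [state, step, preact, signedSum, Matrix.mulVec, dotProduct, weight, Matrix.of_apply]
  congr 1
  rw [Finset.mul_sum, Finset.mul_sum, ← Finset.sum_add_distrib]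
  exact Finset.sum_congr rfl fun j _ => by ring

@[fun_prop]
theorem measurable_preact {n : ℕ} (ρ : ℝ) (ν : Fin n → ℝ) (x : Cube n) :
    Measurable fun r => preact ρ ν r x := by
  unfold preact; fun_prop

theorem measurable_step {n : ℕ} (ρ : ℝ) (x : Cube n) :
    Measurable fun L : Layer n => step ρ L x := by
  refine measurable_pi_lambda _ fun i => measurable_realSign.comp ?_
  unfold preact signedSum
  fun_prop

theorem signedSum_univ_neg {n : ℕ} (x : Cube n) (ν : Fin n → ℝ) :
    signedSum Finset.univ (-x) ν = -signedSum Finset.univ x ν := by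
  simp [signedSum]

theorem preact_neg {n : ℕ} (ρ : ℝ) (ν r : Fin n → ℝ) (x : Cube n) :
    preact ρ ν r (-x) = -preact ρ ν r x := by
  rw [preact, preact, signedSum_univ_neg, signedSum_univ_neg]; ring

theorem realSign_neg {a : ℝ} (ha : a ≠ 0) : realSign (-a) = -realSign a := by
  rcases lt_or_gt_of_ne ha with h | h
  · simp [realSign, h, h.not_gt]
  · simp [realSign, h, h.le]

theorem ae_preact_ne_zero {n : ℕ} (hn : n ≠ 0) {ρ : ℝ} (hρ : ρ < 1) (ν : Fin n → ℝ) (x : Cube n) :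
    ∀ᵐ r ∂stdGaussianPi n, preact ρ ν r x ≠ 0 := by
  have hs : √(1 - ρ) ≠ 0 := (Real.sqrt_pos.2 (by linarith)).ne'
  have hn' : ((Finset.univ : Finset (Fin n)).card : NNReal) ≠ 0 := by simpa using hn
  have := nullSingletonClass_gaussianReal (μ := 0) hn'
  have h : ∀ᵐ t ∂(stdGaussianPi n).map (signedSum Finset.univ x),
      t ≠ -(√ρ * signedSum Finset.univ x ν) / √(1 - ρ) := by
    rw [map_signedSum]
    exact Measure.ae_ne _ _
  filter_upwards [ae_of_ae_map (by fun_prop) h] with r hr h0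
  refine hr ?_
  rw [eq_div_iff hs]
  rw [preact] at h0
  linarith

theorem step_neg_of_preact_ne_zero {n : ℕ} {ρ : ℝ} {L : Layer n} {x : Cube n}
    (h : ∀ i, preact ρ L.1 (L.2 i) x ≠ 0) : step ρ L (-x) = -step ρ L x := by
  ext1 i
  rw [Pi.neg_apply, step, step, preact_neg, realSign_neg (h i)]

/-- With a the sum over the common positions and b the sum over the others, the two inputs see a + b
and a - b, so the output signs differ when |a| ≤ |b|. -/
theorem signedSum_disagree {n : ℕ} (x y : Cube n) (ν : Fin n → ℝ) :
    signedSum Finset.univ x ν =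
        signedSum (disagree x y)ᶜ x ν + signedSum (disagree x y) x ν ∧
      signedSum Finset.univ y ν =
        signedSum (disagree x y)ᶜ x ν - signedSum (disagree x y) x ν := by
  constructor
  · rw [add_comm]
    exact (Finset.sum_add_sum_compl _ _).symm
  · rw [sub_eq_neg_add]
    rw [signedSum, ← Finset.sum_add_sum_compl (disagree x y), signedSum, signedSum,
      ← Finset.sum_neg_distrib]
    congr 1
    · refine Finset.sum_congr rfl fun j hj => ?_
      have hj : x j ≠ y j := by simpa [disagree] using hj
      rw [show y j = -x j by
        rcases Int.units_eq_one_or (x j) with h | h <;>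
          rcases Int.units_eq_one_or (y j) with h' | h' <;> simp_all]
      simp
    · refine Finset.sum_congr rfl fun j hj => ?_
      have hj : x j = y j := by simpa [disagree] using hj
      rw [hj]

theorem realSign_mul_realSign_eq_neg_one_iff {a b : ℝ} (h1 : a + b ≠ 0) (h2 : a - b ≠ 0) :
    realSign (a + b) * realSign (a - b) = -1 ↔ |a| ≤ |b| := by
  have hne : (1 : ℤˣ) ≠ -1 := by decide
  rw [← sq_le_sq]
  rcases lt_or_gt_of_ne h1 with h1 | h1 <;> rcases lt_or_gt_of_ne h2 with h2 | h2
  · simp only [realSign, h1.not_gt, h2.not_gt, if_false]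
    simp only [mul_neg, mul_one, neg_neg, hne, false_iff, not_le]
    nlinarith [mul_pos_of_neg_of_neg h1 h2]
  · simp only [realSign, h1.not_gt, h2, if_false, if_true, mul_one, true_iff]
    nlinarith [mul_neg_of_neg_of_pos h1 h2]
  · simp only [realSign, h1, h2.not_gt, if_false, if_true, one_mul, true_iff]
    nlinarith [mul_neg_of_pos_of_neg h1 h2]
  · simp only [realSign, h1, h2, if_true]
    simp only [mul_one, hne, false_iff, not_le]
    nlinarith [mul_pos h1 h2]

theorem map_gaussianReal_affine (d : ℕ) (s a : ℝ) :
    (gaussianReal 0 d).map (fun t => a + s * t) = gaussianReal a (.mk (s ^ 2) (sq_nonneg _) * d) := by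
  have : (fun t : ℝ => a + s * t) = (fun t => a + t) ∘ fun t => s * t := rfl
  rw [this, ← Measure.map_map (by fun_prop) (by fun_prop), gaussianReal_map_const_mul,
    gaussianReal_map_const_add]
  simp

/-- The hypothesis on `S` covers an empty sum: division by √0 gives 0 and both sides are the point
mass at 0, so `wVec` needs no separate treatment there. -/
theorem map_gaussianReal_scale {d : ℕ} {ρ S : ℝ} (hρ0 : 0 ≤ ρ) (hρ : ρ < 1) (hS : d = 0 → S = 0) :
    (gaussianReal (√(ρ / (1 - ρ)) * (S / √d)) 1).map (fun t => √(1 - ρ) * √d * t) =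
      gaussianReal (√ρ * S) (.mk (√(1 - ρ) ^ 2) (sq_nonneg _) * d) := by
  have hs : √(1 - ρ) ≠ 0 := (Real.sqrt_pos.2 (by linarith)).ne'
  rw [gaussianReal_map_const_mul]
  congr 1
  · rcases eq_or_ne d 0 with rfl | hd
    · simp [hS]
    · have : √(d : ℝ) ≠ 0 := (Real.sqrt_pos.2 (by positivity)).ne'
      rw [Real.sqrt_div hρ0]
      field_simp
  · ext
    simp [mul_pow]

theorem card_compl_disagree {n : ℕ} (x y : Cube n) :
    ((disagree x y)ᶜ.card : ℝ) = n - (disagree x y).card := by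
  rw [Finset.card_compl, Nat.cast_sub (Finset.card_le_univ _)]
  simp

/-- Given the shared vector `ν`, a position of the output differs with probability `g_W(v)`. -/
theorem row_disagree_prob {n : ℕ} (hn : n ≠ 0) {ρ : ℝ} (hρ0 : 0 ≤ ρ) (hρ : ρ < 1)
    (ν : Fin n → ℝ) (x y : Cube n) :
    (stdGaussianPi n).real {r | realSign (preact ρ ν r x) * realSign (preact ρ ν r y) = -1} =
      gProb (wVec ρ ν x y) (disagreeFrac x y) := by
  set C := disagree x y with hC
  have hs : 0 < √(1 - ρ) := Real.sqrt_pos.2 (by linarith)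
  have hn' : (0 : ℝ) < n := by positivity
  set E : Set (ℝ × ℝ) := {q | |q.2| ≤ |q.1|} with hE
  have hEm : MeasurableSet E := measurableSet_le (by fun_prop) (by fun_prop)
  -- The null events on which a preactivation vanishes are discarded, since the sign criterion fails
  -- there.
  have hae : {r | realSign (preact ρ ν r x) * realSign (preact ρ ν r y) = -1} =ᵐ[stdGaussianPi n]
      (fun r => (√ρ * signedSum C x ν + √(1 - ρ) * signedSum C x r,
        √ρ * signedSum Cᶜ x ν + √(1 - ρ) * signedSum Cᶜ x r)) ⁻¹' E := by
    filter_upwards [ae_preact_ne_zero hn hρ ν x, ae_preact_ne_zero hn hρ ν y] with r hx hy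
    have ex : preact ρ ν r x = (√ρ * signedSum Cᶜ x ν + √(1 - ρ) * signedSum Cᶜ x r) +
        (√ρ * signedSum C x ν + √(1 - ρ) * signedSum C x r) := by
      rw [preact, (signedSum_disagree x y ν).1, (signedSum_disagree x y r).1]; ring
    have ey : preact ρ ν r y = (√ρ * signedSum Cᶜ x ν + √(1 - ρ) * signedSum Cᶜ x r) -
        (√ρ * signedSum C x ν + √(1 - ρ) * signedSum C x r) := by
      rw [preact, (signedSum_disagree x y ν).2, (signedSum_disagree x y r).2]; ring
    have := realSign_mul_realSign_eq_neg_one_iff (ex ▸ hx) (ey ▸ hy)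
    rw [← ex, ← ey] at this
    exact propext this
  -- Up to the scales √((1-ρ)d) and √((1-ρ)(n-d)), the two partial sums are the X and Y in the
  -- definition of g.
  have hmap : (stdGaussianPi n).map
      (fun r => (√ρ * signedSum C x ν + √(1 - ρ) * signedSum C x r,
        √ρ * signedSum Cᶜ x ν + √(1 - ρ) * signedSum Cᶜ x r)) =
      ((gaussianReal (wVec ρ ν x y).1 1).prod (gaussianReal (wVec ρ ν x y).2 1)).map
        (fun p => (√(1 - ρ) * √(C.card : ℝ) * p.1, √(1 - ρ) * √(Cᶜ.card : ℝ) * p.2)) := by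
    have h1 := Measure.map_prod_map (gaussianReal (wVec ρ ν x y).1 1)
      (gaussianReal (wVec ρ ν x y).2 1)
      (f := fun t => √(1 - ρ) * √(C.card : ℝ) * t) (g := fun t => √(1 - ρ) * √(Cᶜ.card : ℝ) * t)
      (by fun_prop) (by fun_prop)
    have h2 := Measure.map_prod_map (gaussianReal 0 C.card) (gaussianReal 0 Cᶜ.card)
      (f := fun t => √ρ * signedSum C x ν + √(1 - ρ) * t)
      (g := fun t => √ρ * signedSum Cᶜ x ν + √(1 - ρ) * t) (by fun_prop) (by fun_prop)
    have e1 : (wVec ρ ν x y).1 = √(ρ / (1 - ρ)) * (signedSum C x ν / √(C.card : ℝ)) := rfl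
    have e2 : (wVec ρ ν x y).2 = √(ρ / (1 - ρ)) * (signedSum Cᶜ x ν / √(Cᶜ.card : ℝ)) := by
      rw [card_compl_disagree]; rfl
    have z : ∀ s : Finset (Fin n), s.card = 0 → signedSum s x ν = 0 := fun s hs => by
      rw [Finset.card_eq_zero] at hs
      simp [hs, signedSum]
    rw [e1, e2, map_gaussianReal_scale hρ0 hρ (z _), map_gaussianReal_scale hρ0 hρ (z _)] at h1
    rw [map_gaussianReal_affine, map_gaussianReal_affine, ← map_signedSum_prod C x,
      Measure.map_map (by fun_prop) (by fun_prop)] at h2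
    rw [e1, e2]
    exact h2.symm.trans h1
  rw [measureReal_congr hae, ← map_measureReal_apply (by fun_prop) hEm, hmap,
    map_measureReal_apply (by fun_prop) hEm, gProb]
  congr 1
  ext p
  have hv : √(disagreeFrac x y) = √(C.card : ℝ) / √n := by
    rw [disagreeFrac, Real.sqrt_div (by positivity)]
  have hv' : √(1 - disagreeFrac x y) = √(Cᶜ.card : ℝ) / √n := by
    rw [disagreeFrac, card_compl_disagree, ← Real.sqrt_div (by
      rw [← card_compl_disagree]; positivity), sub_div, div_self hn'.ne']
  simp only [hE, Set.mem_preimage, Set.mem_ofPred_eq, abs_mul, abs_of_pos hs, hv, hv',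
    abs_of_nonneg (Real.sqrt_nonneg _)]
  rw [mul_assoc, mul_assoc, mul_le_mul_iff_right₀ hs, div_mul_eq_mul_div, div_mul_eq_mul_div,
    div_le_div_iff_of_pos_right (by positivity)]

theorem gProb_nonneg (w : ℝ × ℝ) (v : ℝ) : 0 ≤ gProb w v := measureReal_nonneg

theorem gProb_le_one (w : ℝ × ℝ) (v : ℝ) : gProb w v ≤ 1 := measureReal_le_one

/-- The law of the private matrix `ψ`. -/
def privateLaw (n : ℕ) : Measure (Fin n → Fin n → ℝ) := Measure.pi fun _ => stdGaussianPi n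

instance instIsProbabilityMeasurePrivateLaw (n : ℕ) : IsProbabilityMeasure (privateLaw n) := by
  unfold privateLaw; infer_instance

theorem layerLaw_eq (n : ℕ) : layerLaw n = (stdGaussianPi n).prod (privateLaw n) := rfl

/-- Given the shared vector, the products `x_t(i) y_t(i)` are i.i.d. signs, equal to `-1` with
probability `g_W(v)`. -/
theorem map_step_mul_step {n : ℕ} (hn : n ≠ 0) {ρ : ℝ} (hρ0 : 0 ≤ ρ) (hρ : ρ < 1)
    (ν : Fin n → ℝ) (x y : Cube n) :
    (privateLaw n).map (fun ψ => step ρ (ν, ψ) x * step ρ (ν, ψ) y) =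
      cubeBernoulli n (1 - gProb (wVec ρ ν x y) (disagreeFrac x y)) := by
  set φ : (Fin n → ℝ) → ℤˣ := fun r => realSign (preact ρ ν r x) * realSign (preact ρ ν r y)
  have hφ : Measurable φ :=
    (measurable_of_countable fun p : ℤˣ × ℤˣ => p.1 * p.2).comp
      ((measurable_realSign.comp (measurable_preact ρ ν x)).prodMk
        (measurable_realSign.comp (measurable_preact ρ ν y)))
  have hprob := Measure.isProbabilityMeasure_map (μ := stdGaussianPi n) hφ.aemeasurable
  have h : (stdGaussianPi n).map φ =
      signBernoulli (1 - gProb (wVec ρ ν x y) (disagreeFrac x y)) := by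
    rw [eq_signBernoulli (μ := (stdGaussianPi n).map φ),
      map_measureReal_apply hφ (measurableSet_singleton _),
      ← row_disagree_prob hn hρ0 hρ ν x y]
    rfl
  rw [cubeBernoulli, ← h, ← Measure.pi_map_pi (fun _ => hφ.aemeasurable)]
  rfl

/-! ### The first layer and the remaining layers -/

/-- Prepending a layer maps the product law to the infinite product, by uniqueness on cylinder sets;
splitting is its inverse. This supplies the Markov property. -/
theorem measurePreserving_head_tail (n : ℕ) :
    MeasurePreserving (fun Θ : ℕ → Layer n => (Θ 0, fun t => Θ (t + 1))) (networkLaw n)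
      ((layerLaw n).prod (networkLaw n)) := by
  set cons : Layer n × (ℕ → Layer n) → ℕ → Layer n :=
    fun p t => Nat.casesOn t p.1 fun s => p.2 s with hcons
  have hm : Measurable cons := by
    refine measurable_pi_lambda _ fun t => ?_
    cases t with
    | zero => exact measurable_fst
    | succ s => exact (measurable_pi_apply s).comp measurable_snd
  have hmap : ((layerLaw n).prod (networkLaw n)).map cons = networkLaw n := by
    refine Measure.eq_infinitePi _ fun s t ht => ?_
    classical
    obtain ⟨N, hN⟩ := s.exists_nat_subset_range
    -- Padding the cylinder with the whole space makes its index set an initial segment, which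
    -- splits into 0 and a shifted segment.
    set t' : ℕ → Set (Layer n) := fun i => if i ∈ s then t i else Set.univ with ht'
    have ht'm : ∀ i, MeasurableSet (t' i) := fun i => by
      by_cases hi : i ∈ s
      · simp only [ht', hi, if_true, ht i]
      · simp only [ht', hi, if_false, MeasurableSet.univ]
    have h1 : cons ⁻¹' (s : Set ℕ).pi t =
        t' 0 ×ˢ ((Finset.range N : Finset ℕ) : Set ℕ).pi fun i => t' (i + 1) := by
      ext p
      simp only [Set.mem_preimage, Set.mem_pi, Set.mem_prod, Finset.mem_coe, Finset.mem_range]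
      constructor
      · intro h
        refine ⟨?_, fun i _ => ?_⟩
        · by_cases h0 : 0 ∈ s
          · simp only [ht', h0, if_true]
            exact h 0 h0
          · simp only [ht', h0, if_false, Set.mem_univ]
        · by_cases h0 : i + 1 ∈ s
          · simpa only [ht', h0, if_true] using h (i + 1) h0
          · simp only [ht', h0, if_false, Set.mem_univ]
      · rintro ⟨h0, h⟩ i hi
        cases i with
        | zero =>
          simp only [ht', hi, if_true] at h0
          exact h0
        | succ i =>
          have := h i (by have := Finset.mem_range.1 (hN hi); omega)
          simpa only [ht', hi, if_true] using this
    have h2 : ∏ i ∈ s, layerLaw n (t i) = ∏ i ∈ Finset.range (N + 1), layerLaw n (t' i) := by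
      rw [← Finset.prod_subset (hN.trans (Finset.range_subset_range.2 N.le_succ))]
      · exact Finset.prod_congr rfl fun i hi => by simp only [ht', hi, if_true]
      · intro i _ hi
        simp only [ht', hi, if_false, measure_univ]
    rw [Measure.map_apply hm (MeasurableSet.pi s.countable_toSet fun i _ => ht i), h1,
      Measure.prod_prod, networkLaw, Measure.infinitePi_pi _ (fun i _ => ht'm _), h2,
      Finset.prod_range_succ', mul_comm]
  have hsplit : Measurable fun Θ : ℕ → Layer n => (Θ 0, fun t => Θ (t + 1)) := by fun_prop
  refine ⟨hsplit, ?_⟩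
  conv_lhs => rw [← hmap]
  rw [Measure.map_map hsplit hm]
  exact Measure.map_id

theorem state_succ' {n : ℕ} (ρ : ℝ) (Θ : ℕ → Layer n) (x : Cube n) (t : ℕ) :
    state ρ Θ x (t + 1) = state ρ (fun s => Θ (s + 1)) (step ρ (Θ 0) x) t := by
  induction t with
  | zero => rw [state_succ]; rfl
  | succ t ih => rw [state_succ, ih, state_succ]

theorem integral_networkLaw_head_tail {n : ℕ} {F : Layer n → (ℕ → Layer n) → ℝ}
    (hF : Measurable (Function.uncurry F)) {C : ℝ} (hC : ∀ L Θ, |F L Θ| ≤ C) :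
    ∫ Θ, F (Θ 0) (fun t => Θ (t + 1)) ∂networkLaw n =
      ∫ L, ∫ Θ, F L Θ ∂networkLaw n ∂layerLaw n := by
  have h := measurePreserving_head_tail n
  have hint : Integrable (Function.uncurry F) ((layerLaw n).prod (networkLaw n)) :=
    Integrable.of_bound hF.aestronglyMeasurable C (ae_of_all _ fun p => hC _ _)
  calc ∫ Θ, F (Θ 0) (fun t => Θ (t + 1)) ∂networkLaw n
      = ∫ p, Function.uncurry F p ∂((layerLaw n).prod (networkLaw n)) := by
        rw [← h.map_eq, integral_map h.measurable.aemeasurable hF.aestronglyMeasurable]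
        rfl
    _ = _ := integral_prod _ hint

/-! ### Oddness of the network -/

/-- `realSign` is odd only away from 0. The private Gaussian sum has no atoms, and there are
finitely many inputs and rows, so 0 is avoided simultaneously. -/
theorem ae_layer_preact_ne_zero {n : ℕ} {ρ : ℝ} (hρ : ρ < 1) :
    ∀ᵐ L ∂layerLaw n, ∀ (x : Cube n) (i : Fin n), preact ρ L.1 (L.2 i) x ≠ 0 := by
  rcases eq_or_ne n 0 with rfl | hn
  · exact ae_of_all _ fun L x i => i.elim0
  rw [layerLaw_eq]
  have hmeas : MeasurableSet {L : Layer n | ∀ (x : Cube n) (i : Fin n),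
      preact ρ L.1 (L.2 i) x ≠ 0} := by
    have : {L : Layer n | ∀ (x : Cube n) (i : Fin n), preact ρ L.1 (L.2 i) x ≠ 0} =
        ⋂ x : Cube n, ⋂ i : Fin n, {L : Layer n | preact ρ L.1 (L.2 i) x = 0}ᶜ := by
      ext L; simp
    rw [this]
    refine MeasurableSet.iInter fun x => MeasurableSet.iInter fun i => MeasurableSet.compl ?_
    refine measurableSet_eq_fun ?_ measurable_const
    unfold preact signedSum
    fun_prop
  refine (Measure.ae_prod_iff_ae_ae hmeas).2 (ae_of_all _ fun ν => ?_)
  rw [ae_all_iff]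
  intro x
  rw [ae_all_iff]
  intro i
  exact (Measure.quasiMeasurePreserving_eval (μ := fun _ : Fin n => stdGaussianPi n) i).ae
    (ae_preact_ne_zero hn hρ ν x)

theorem ae_network_odd {n : ℕ} {ρ : ℝ} (hρ : ρ < 1) (T : ℕ) {h : BoolFun n}
    (hh : Function.Odd h) : ∀ᵐ Θ ∂networkLaw n, Function.Odd (network ρ T h Θ) := by
  have hall : ∀ᵐ Θ ∂networkLaw n, ∀ t (x : Cube n) (i : Fin n),
      preact ρ (Θ t).1 ((Θ t).2 i) x ≠ 0 := by
    rw [ae_all_iff]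
    exact fun t => (measurePreserving_eval_infinitePi (fun _ : ℕ => layerLaw n)
      t).quasiMeasurePreserving.ae (ae_layer_preact_ne_zero hρ)
  filter_upwards [hall] with Θ hΘ x
  have : ∀ t, state ρ Θ (-x) t = -state ρ Θ x t := by
    intro t
    induction t with
    | zero => rfl
    | succ t ih =>
      rw [state_succ, state_succ, ih, step_neg_of_preact_ne_zero fun i => hΘ t _ i]
  rw [network, network, this, hh]

/-! ### Correlation of the outputs -/

/-- The expected product of the outputs at the inputs `x` and `y`. -/
def outputCorr {n : ℕ} (ρ : ℝ) (h : BoolFun n) (m : ℕ) (x y : Cube n) : ℝ :=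
  ∫ Θ, signVal (h (state ρ Θ x m)) * signVal (h (state ρ Θ y m)) ∂networkLaw n

theorem measurable_output {n : ℕ} (ρ : ℝ) (h : BoolFun n) (m : ℕ) (x : Cube n) :
    Measurable fun Θ : ℕ → Layer n => signVal (h (state ρ Θ x m)) :=
  (measurable_of_countable fun z : Cube n => signVal (h z)).comp (measurable_state ρ x m)

theorem abs_signVal_mul (u v : ℤˣ) : |signVal u * signVal v| = 1 := by
  rw [abs_mul, abs_signVal, abs_signVal, one_mul]

theorem outputCorr_le_one {n : ℕ} (ρ : ℝ) (h : BoolFun n) (m : ℕ) (x y : Cube n) :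
    outputCorr ρ h m x y ≤ 1 := by
  have hint : Integrable (fun Θ : ℕ → Layer n =>
      signVal (h (state ρ Θ x m)) * signVal (h (state ρ Θ y m))) (networkLaw n) :=
    Integrable.of_bound ((measurable_output ρ h m x).mul
      (measurable_output ρ h m y)).aestronglyMeasurable 1 (ae_of_all _ fun Θ => by
        rw [Real.norm_eq_abs, abs_signVal_mul])
  calc outputCorr ρ h m x y ≤ ∫ _, (1 : ℝ) ∂networkLaw n :=
        integral_mono hint (integrable_const _) fun Θ =>
          (le_abs_self _).trans (abs_signVal_mul _ _).le
    _ = 1 := by simp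

theorem outputCorr_succ {n : ℕ} (ρ : ℝ) (h : BoolFun n) (m : ℕ) (x y : Cube n) :
    outputCorr ρ h (m + 1) x y =
      ∫ L, outputCorr ρ h m (step ρ L x) (step ρ L y) ∂layerLaw n := by
  have hm : Measurable fun p : (ℕ → Layer n) × (Cube n × Cube n) =>
      signVal (h (state ρ p.1 p.2.1 m)) * signVal (h (state ρ p.1 p.2.2 m)) :=
    measurable_from_prod_countable_left fun q =>
      (measurable_output ρ h m q.1).mul (measurable_output ρ h m q.2)
  have hF : Measurable (Function.uncurry fun (L : Layer n) (Θ : ℕ → Layer n) =>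
      signVal (h (state ρ Θ (step ρ L x) m)) * signVal (h (state ρ Θ (step ρ L y) m))) :=
    hm.comp (measurable_snd.prodMk (((measurable_step ρ x).comp measurable_fst).prodMk
      ((measurable_step ρ y).comp measurable_fst)))
  have := integral_networkLaw_head_tail hF (C := 1) fun L Θ => (abs_signVal_mul _ _).le
  simp only [outputCorr, state_succ']
  exact this

/-- Flipping the signs of the columns of a layer. -/
def flipLayer {n : ℕ} (a : Cube n) (L : Layer n) : Layer n :=
  (fun j => signVal (a j) * L.1 j, fun i j => signVal (a j) * L.2 i j)

theorem measurePreserving_flipLayer {n : ℕ} (a : Cube n) :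
    MeasurePreserving (flipLayer a) (layerLaw n) (layerLaw n) := by
  have h0 : MeasurePreserving (fun (ν : Fin n → ℝ) j => signVal (a j) * ν j)
      (stdGaussianPi n) (stdGaussianPi n) :=
    measurePreserving_pi _ _ fun j => ⟨by fun_prop, map_signVal_mul_gaussianReal _⟩
  exact h0.prod (measurePreserving_pi _ _ fun _ => h0)

theorem step_flipLayer {n : ℕ} (ρ : ℝ) (a : Cube n) (L : Layer n) (x : Cube n) :
    step ρ (flipLayer a L) x = step ρ L (a * x) := by
  ext1 i
  simp only [step, preact, flipLayer, signedSum, Pi.mul_apply, signVal_mul]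
  congr 4 <;> exact funext fun j => by ring

/-- Multiplying both inputs by `a` is the same as flipping columns of the first layer. This needs at
least one layer, whence `m + 1`. -/
theorem outputCorr_mul_left {n : ℕ} (ρ : ℝ) (h : BoolFun n) (m : ℕ) (a x y : Cube n) :
    outputCorr ρ h (m + 1) (a * x) (a * y) = outputCorr ρ h (m + 1) x y := by
  have hm : Measurable fun L : Layer n => outputCorr ρ h m (step ρ L x) (step ρ L y) :=
    (measurable_of_countable fun q : Cube n × Cube n => outputCorr ρ h m q.1 q.2).comp
      ((measurable_step ρ x).prodMk (measurable_step ρ y))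
  rw [outputCorr_succ, outputCorr_succ]
  conv_rhs => rw [← (measurePreserving_flipLayer a).map_eq]
  rw [integral_map (measurePreserving_flipLayer a).measurable.aemeasurable
    hm.aestronglyMeasurable]
  simp only [step_flipLayer]

theorem integral_outputCorr_noisyPair {n : ℕ} (ρ : ℝ) (h : BoolFun n) (m : ℕ) {ε : ℝ}
    (h0 : 0 ≤ ε) (h1 : ε ≤ 1) :
    ∫ p, outputCorr ρ h m p.1 p.2 ∂noisyPair n ε =
      ∫ Θ, noiseCorr ε (network ρ m h Θ) ∂networkLaw n := by
  have := isProbabilityMeasure_noisyPair n h0 h1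
  have hm : Measurable fun p : (ℕ → Layer n) × (Cube n × Cube n) =>
      signVal (h (state ρ p.1 p.2.1 m)) * signVal (h (state ρ p.1 p.2.2 m)) :=
    measurable_from_prod_countable_left fun q =>
      (measurable_output ρ h m q.1).mul (measurable_output ρ h m q.2)
  exact integral_integral_swap (Integrable.of_bound (hm.comp measurable_swap).aestronglyMeasurable
    1 (ae_of_all _ fun p => (abs_signVal_mul _ _).le))

/-- The probability, given the shared vector, that a position of the next pair differs. -/
def flipProb {n : ℕ} (ρ : ℝ) (ν : Fin n → ℝ) (x y : Cube n) : ℝ :=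
  gProb (wVec ρ ν x y) (disagreeFrac x y)

/-- Only the product of the new pair matters, and it consists of i.i.d. signs that are `-1` with
probability g. The integral is therefore the mean noise correlation, at level g ≥ 1/2, of a network
that is almost surely odd. -/
theorem integral_outputCorr_step_nonpos {n : ℕ} (hn : n ≠ 0) {ρ : ℝ} (hρ0 : 0 ≤ ρ) (hρ : ρ < 1)
    {h : BoolFun n} (hh : Function.Odd h) (m : ℕ) {ν : Fin n → ℝ} {x y : Cube n}
    (hg : 1 / 2 ≤ flipProb ρ ν x y) :
    ∫ ψ, outputCorr ρ h (m + 1) (step ρ (ν, ψ) x) (step ρ (ν, ψ) y) ∂privateLaw n ≤ 0 := by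
  have hg1 : flipProb ρ ν x y ≤ 1 := gProb_le_one _ _
  have hxx : ∀ x : Cube n, x * x = 1 := fun x => funext fun i => Int.units_mul_self _
  have hmul : ∀ x y : Cube n, outputCorr ρ h (m + 1) x y = outputCorr ρ h (m + 1) 1 (x * y) :=
    fun x y => by rw [← outputCorr_mul_left ρ h m x x y, hxx]
  have hms : Measurable fun ψ : Fin n → Fin n → ℝ => step ρ (ν, ψ) x * step ρ (ν, ψ) y :=
    (measurable_of_countable fun p : Cube n × Cube n => p.1 * p.2).comp
      (((measurable_step ρ x).prodMk (measurable_step ρ y)).comp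
        (measurable_const.prodMk measurable_id))
  have e1 : ∫ ψ, outputCorr ρ h (m + 1) (step ρ (ν, ψ) x) (step ρ (ν, ψ) y) ∂privateLaw n =
      ∫ z, outputCorr ρ h (m + 1) 1 z ∂cubeBernoulli n (1 - flipProb ρ ν x y) := by
    rw [flipProb, ← map_step_mul_step hn hρ0 hρ ν x y,
      integral_map hms.aemeasurable (measurable_of_countable _).aestronglyMeasurable]
    simp only [← hmul]
  have := isProbabilityMeasure_cubeBernoulli n (p := 1 / 2) (by norm_num) (by norm_num)
  -- A uniform first input can be inserted for free, because the correlation of (x, xz) does not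
  -- depend on x.
  have e2 : ∫ z, outputCorr ρ h (m + 1) 1 z ∂cubeBernoulli n (1 - flipProb ρ ν x y) =
      ∫ p, outputCorr ρ h (m + 1) p.1 p.2 ∂noisyPair n (flipProb ρ ν x y) := by
    rw [integral_noisyPair (by linarith) hg1]
    refine integral_congr_ae (ae_of_all _ fun z => ?_)
    have : ∀ x : Cube n, outputCorr ρ h (m + 1) x (x * z) = outputCorr ρ h (m + 1) 1 z :=
      fun x => by rw [hmul, ← mul_assoc, hxx, one_mul]
    simp only [this, integral_const, probReal_univ, one_smul]
  rw [e1, e2, integral_outputCorr_noisyPair ρ h _ (by linarith) hg1]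
  refine integral_nonpos_of_ae ?_
  filter_upwards [ae_network_odd hρ (m + 1) hh] with Θ hΘ
  exact noiseCorr_nonpos hg hg1 hΘ

/-! ### The chain killed when `g ≥ 1/2` -/

theorem measurable_gProb (v : ℝ) : Measurable fun w => gProb w v := by
  -- Translating both Gaussians to mean 0 moves the dependence on w into the event, so that g is the
  -- measure of a section.
  have hE : MeasurableSet {q : (ℝ × ℝ) × (ℝ × ℝ) |
      √(1 - v) * |q.1.2 + q.2.2| ≤ √v * |q.1.1 + q.2.1|} :=
    measurableSet_le (by fun_prop) (by fun_prop)
  have h := (measurable_measure_prodMk_left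
    (ν := (gaussianReal 0 1).prod (gaussianReal 0 1)) hE).ennreal_toReal
  convert h using 1
  ext w
  have hg : ∀ a : ℝ, gaussianReal a 1 = (gaussianReal 0 1).map fun t => a + t := fun a => by
    rw [gaussianReal_map_const_add, zero_add]
  rw [gProb, hg w.1, hg w.2, Measure.map_prod_map _ _ (by fun_prop) (by fun_prop),
    map_measureReal_apply (by fun_prop) (measurableSet_le (by fun_prop) (by fun_prop))]
  rfl

theorem measurable_flipProb {n : ℕ} (ρ : ℝ) (x y : Cube n) :
    Measurable fun ν => flipProb ρ ν x y := by
  refine (measurable_gProb _).comp ?_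
  unfold wVec
  fun_prop

theorem measurableSet_flipProb_lt {n : ℕ} (ρ : ℝ) (x y : Cube n) :
    MeasurableSet {L : Layer n | flipProb ρ L.1 x y < 1 / 2} :=
  measurableSet_lt ((measurable_flipProb ρ x y).comp measurable_fst) measurable_const

/-- The law of the next pair on the event `g < 1/2`. -/
def killedLaw {n : ℕ} (ρ : ℝ) (p : Cube n × Cube n) : Measure (Cube n × Cube n) :=
  ((layerLaw n).restrict {L | flipProb ρ L.1 p.1 p.2 < 1 / 2}).map
    fun L => (step ρ L p.1, step ρ L p.2)

instance instIsFiniteMeasureKilledLaw {n : ℕ} (ρ : ℝ) (p : Cube n × Cube n) :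
    IsFiniteMeasure (killedLaw ρ p) := by
  unfold killedLaw; infer_instance

/-- The transition operator of the killed chain. -/
def killOp {n : ℕ} (ρ : ℝ) (φ : Cube n × Cube n → ℝ) (p : Cube n × Cube n) : ℝ :=
  ∫ q, φ q ∂killedLaw ρ p

theorem measurable_step_pair {n : ℕ} (ρ : ℝ) (x y : Cube n) :
    Measurable fun L : Layer n => (step ρ L x, step ρ L y) :=
  (measurable_step ρ x).prodMk (measurable_step ρ y)

theorem killOp_eq {n : ℕ} (ρ : ℝ) (φ : Cube n × Cube n → ℝ) (x y : Cube n) :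
    killOp ρ φ (x, y) =
      ∫ L in {L | flipProb ρ L.1 x y < 1 / 2}, φ (step ρ L x, step ρ L y) ∂layerLaw n :=
  integral_map (measurable_step_pair ρ x y).aemeasurable
    (measurable_of_countable _).aestronglyMeasurable

theorem integrable_step_pair {n : ℕ} (ρ : ℝ) (φ : Cube n × Cube n → ℝ) (x y : Cube n)
    (s : Set (Layer n)) :
    Integrable (fun L : Layer n => φ (step ρ L x, step ρ L y)) ((layerLaw n).restrict s) :=
  (Integrable.of_finite (f := φ) (μ := ((layerLaw n).restrict s).map fun L : Layer n =>
    (step ρ L x, step ρ L y))).comp_measurable (measurable_step_pair ρ x y)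

theorem killOp_eq_integral_integral {n : ℕ} (ρ : ℝ) (φ : Cube n × Cube n → ℝ) (x y : Cube n) :
    killOp ρ φ (x, y) = ∫ ν in {ν | flipProb ρ ν x y < 1 / 2},
      ∫ ψ, φ (step ρ (ν, ψ) x, step ρ (ν, ψ) y) ∂privateLaw n ∂stdGaussianPi n := by
  have h := integrable_step_pair ρ φ x y {L | flipProb ρ L.1 x y < 1 / 2}
  rw [killOp_eq]
  have hs : (layerLaw n).restrict {L | flipProb ρ L.1 x y < 1 / 2} =
      ((stdGaussianPi n).restrict {ν | flipProb ρ ν x y < 1 / 2}).prod (privateLaw n) := by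
    conv_rhs => rw [← Measure.restrict_univ (μ := privateLaw n)]
    rw [Measure.prod_restrict, layerLaw_eq]
    congr 1
    ext L
    simp
  rw [hs] at h ⊢
  exact integral_prod _ h

theorem killOp_mono {n : ℕ} (ρ : ℝ) {φ φ' : Cube n × Cube n → ℝ} (h : ∀ p, φ p ≤ φ' p)
    (p : Cube n × Cube n) : killOp ρ φ p ≤ killOp ρ φ' p :=
  integral_mono Integrable.of_finite Integrable.of_finite h

theorem killOp_add {n : ℕ} (ρ : ℝ) (φ φ' : Cube n × Cube n → ℝ) :
    killOp ρ (fun p => φ p + φ' p) = fun p => killOp ρ φ p + killOp ρ φ' p :=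
  funext fun _ => integral_add Integrable.of_finite Integrable.of_finite

theorem killOp_const_mul {n : ℕ} (ρ c : ℝ) (φ : Cube n × Cube n → ℝ) :
    killOp ρ (fun p => c * φ p) = fun p => c * killOp ρ φ p :=
  funext fun _ => integral_const_mul _ _

theorem killOp_nonneg {n : ℕ} (ρ : ℝ) {φ : Cube n × Cube n → ℝ} (h : ∀ p, 0 ≤ φ p)
    (p : Cube n × Cube n) : 0 ≤ killOp ρ φ p :=
  integral_nonneg h

/-- The probability that the chain started at `p` is not killed in the first `m` steps. -/
def survProb {n : ℕ} (ρ : ℝ) (m : ℕ) : Cube n × Cube n → ℝ := (killOp ρ)^[m] fun _ => 1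

theorem survProb_succ {n : ℕ} (ρ : ℝ) (m : ℕ) :
    survProb (n := n) ρ (m + 1) = killOp ρ (survProb ρ m) :=
  Function.iterate_succ_apply' _ _ _

theorem survProb_nonneg {n : ℕ} (ρ : ℝ) (m : ℕ) (p : Cube n × Cube n) : 0 ≤ survProb ρ m p := by
  induction m generalizing p with
  | zero => exact zero_le_one
  | succ m ih => rw [survProb_succ]; exact killOp_nonneg ρ ih p

theorem killOp_one_le_one {n : ℕ} (ρ : ℝ) (p : Cube n × Cube n) :
    killOp ρ (fun _ => 1) p ≤ 1 := by
  rw [killOp_eq, setIntegral_const, smul_eq_mul, mul_one]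
  exact measureReal_le_one

theorem survProb_le_one {n : ℕ} (ρ : ℝ) (m : ℕ) (p : Cube n × Cube n) : survProb ρ m p ≤ 1 := by
  induction m generalizing p with
  | zero => exact le_rfl
  | succ m ih => rw [survProb_succ]; exact (killOp_mono ρ ih p).trans (killOp_one_le_one ρ p)

/-- The event that `g < 1/2` at the first `m` layers. -/
def noHit {n : ℕ} (ρ : ℝ) (m : ℕ) (x y : Cube n) : Set (ℕ → Layer n) :=
  {Θ | ∀ s < m, flipProb ρ (Θ s).1 (state ρ Θ x s) (state ρ Θ y s) < 1 / 2}

theorem measurable_flipProb_uncurry {n : ℕ} (ρ : ℝ) :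
    Measurable fun q : (Fin n → ℝ) × (Cube n × Cube n) => flipProb ρ q.1 q.2.1 q.2.2 :=
  measurable_from_prod_countable_left fun p => measurable_flipProb ρ p.1 p.2

theorem measurable_flipProb_state {n : ℕ} (ρ : ℝ) (x y : Cube n) (s : ℕ) :
    Measurable fun Θ : ℕ → Layer n => flipProb ρ (Θ s).1 (state ρ Θ x s) (state ρ Θ y s) := by
  have h' : Measurable fun Θ : ℕ → Layer n => ((Θ s).1, (state ρ Θ x s, state ρ Θ y s)) := by
    refine Measurable.prodMk ?_ ((measurable_state ρ x s).prodMk (measurable_state ρ y s))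
    exact measurable_fst.comp (measurable_pi_apply s)
  have := (measurable_flipProb_uncurry ρ).comp h'
  simp only [Function.comp_def] at this
  exact this

theorem measurableSet_noHit {n : ℕ} (ρ : ℝ) (m : ℕ) (x y : Cube n) :
    MeasurableSet (noHit ρ m x y) := by
  have : noHit ρ m x y = ⋂ s : ℕ, ⋂ _ : s < m,
      {Θ : ℕ → Layer n | flipProb ρ (Θ s).1 (state ρ Θ x s) (state ρ Θ y s) < 1 / 2} := by
    ext Θ; simp [noHit]
  rw [this]
  exact MeasurableSet.iInter fun s => MeasurableSet.iInter fun _ =>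
    measurableSet_lt (measurable_flipProb_state ρ x y s) measurable_const

theorem mem_noHit_succ {n : ℕ} {ρ : ℝ} {m : ℕ} {x y : Cube n} {Θ : ℕ → Layer n} :
    Θ ∈ noHit ρ (m + 1) x y ↔ flipProb ρ (Θ 0).1 x y < 1 / 2 ∧
      (fun t => Θ (t + 1)) ∈ noHit ρ m (step ρ (Θ 0) x) (step ρ (Θ 0) y) := by
  constructor
  · intro h
    refine ⟨h 0 (Nat.succ_pos _), fun s hs => ?_⟩
    have := h (s + 1) (by omega)
    rwa [state_succ', state_succ'] at this
  · rintro ⟨h0, h⟩ s hs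
    cases s with
    | zero => exact h0
    | succ s =>
      rw [state_succ', state_succ']
      exact h s (by omega)

/-- Conditioning on the first layer reproduces one application of `killOp`. -/
theorem networkLaw_real_noHit {n : ℕ} (ρ : ℝ) (m : ℕ) (x y : Cube n) :
    (networkLaw n).real (noHit ρ m x y) = survProb ρ m (x, y) := by
  induction m generalizing x y with
  | zero => simp [noHit, survProb]
  | succ m ih =>
    have hm : MeasurableSet {q : (ℕ → Layer n) × (Cube n × Cube n) |
        q.1 ∈ noHit ρ m q.2.1 q.2.2} := by
      have : Measurable fun q : (ℕ → Layer n) × (Cube n × Cube n) =>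
          q.1 ∈ noHit ρ m q.2.1 q.2.2 :=
        measurable_from_prod_countable_left fun p =>
          (measurableSet_noHit ρ m p.1 p.2).mem
      exact measurableSet_setOfPred.2 this
    set S : Set (Layer n × (ℕ → Layer n)) := {q | flipProb ρ q.1.1 x y < 1 / 2 ∧
      q.2 ∈ noHit ρ m (step ρ q.1 x) (step ρ q.1 y)}
    have hmem : ∀ L Θ, (L, Θ) ∈ S ↔ flipProb ρ L.1 x y < 1 / 2 ∧
        Θ ∈ noHit ρ m (step ρ L x) (step ρ L y) := fun _ _ => Iff.rfl
    have hSm : MeasurableSet S := by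
      refine MeasurableSet.inter (measurable_fst (measurableSet_flipProb_lt ρ x y)) ?_
      exact (measurable_snd.prodMk ((measurable_step_pair ρ x y).comp measurable_fst)) hm
    have hpre : noHit ρ (m + 1) x y =
        (fun Θ : ℕ → Layer n => (Θ 0, fun t => Θ (t + 1))) ⁻¹' S := by
      ext Θ
      exact mem_noHit_succ
    have hint := integral_networkLaw_head_tail
      (F := fun (L : Layer n) Θ => S.indicator (fun _ => (1 : ℝ)) (L, Θ))
      (measurable_const.indicator hSm) (C := 1) fun L Θ => by
        by_cases hq : (L, Θ) ∈ S <;> simp [hq]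
    rw [← integral_indicator_one (measurableSet_noHit ρ (m + 1) x y), survProb_succ, killOp_eq,
      ← integral_indicator (measurableSet_flipProb_lt ρ x y)]
    calc ∫ Θ, (noHit ρ (m + 1) x y).indicator 1 Θ ∂networkLaw n
        = ∫ Θ, S.indicator (fun _ => (1 : ℝ)) (Θ 0, fun t => Θ (t + 1)) ∂networkLaw n := by
          rw [hpre]; rfl
      _ = ∫ L, ∫ Θ, S.indicator (fun _ => (1 : ℝ)) (L, Θ) ∂networkLaw n ∂layerLaw n := hint
      _ = _ := by
          refine integral_congr_ae (ae_of_all _ fun L => ?_)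
          by_cases hL : flipProb ρ L.1 x y < 1 / 2
          · rw [Set.indicator_of_mem (by exact hL), ← ih,
              ← integral_indicator_one (measurableSet_noHit ρ m _ _)]
            refine integral_congr_ae (ae_of_all _ fun Θ => ?_)
            have hiff := (hmem L Θ).trans (and_iff_right hL)
            beta_reduce
            by_cases hq : Θ ∈ noHit ρ m (step ρ L x) (step ρ L y)
            · rw [Set.indicator_of_mem (hiff.2 hq), Set.indicator_of_mem hq, Pi.one_apply]
            · rw [Set.indicator_of_notMem (mt hiff.1 hq), Set.indicator_of_notMem hq]
          · rw [Set.indicator_of_notMem (by exact hL)]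
            simp only [Set.indicator, hmem, hL, false_and, if_false, integral_zero]

/-- After the first layer with `g ≥ 1/2`, the outputs of an odd function are not positively
correlated. -/
theorem outputCorr_succ_le_survProb {n : ℕ} (hn : n ≠ 0) {ρ : ℝ} (hρ0 : 0 ≤ ρ) (hρ : ρ < 1)
    {h : BoolFun n} (hh : Function.Odd h) (m : ℕ) (x y : Cube n) :
    outputCorr ρ h (m + 1) x y ≤ survProb ρ m (x, y) := by
  induction m generalizing x y with
  -- The index offset reserves the last layer for the column symmetry: m layers are tested for a hit
  -- in a network of m + 1 layers.
  | zero => exact outputCorr_le_one ρ h 1 x y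
  | succ m ih =>
    have hi := fun φ : Cube n × Cube n → ℝ => by
      have := integrable_step_pair ρ φ x y Set.univ
      rw [Measure.restrict_univ, layerLaw_eq] at this
      exact this
    have hii := fun φ : Cube n × Cube n → ℝ => (hi φ).integral_prod_left
    rw [outputCorr_succ, survProb_succ, killOp_eq_integral_integral, layerLaw_eq,
      integral_prod _ (hi fun q => outputCorr ρ h (m + 1) q.1 q.2),
      ← integral_indicator (measurableSet_lt (measurable_flipProb ρ x y) measurable_const)]
    refine integral_mono (hii fun q => outputCorr ρ h (m + 1) q.1 q.2) ((hii _).indicator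
      (measurableSet_lt (measurable_flipProb ρ x y) measurable_const)) fun ν => ?_
    by_cases hν : flipProb ρ ν x y < 1 / 2
    · rw [Set.indicator_of_mem (by exact hν)]
      have hj := fun φ : Cube n × Cube n → ℝ => (Integrable.of_finite (f := φ)
        (μ := (privateLaw n).map fun ψ => (step ρ (ν, ψ) x, step ρ (ν, ψ) y))).comp_measurable
          ((measurable_step_pair ρ x y).comp (measurable_const.prodMk measurable_id))
      exact integral_mono (hj fun q => outputCorr ρ h (m + 1) q.1 q.2) (hj _) fun ψ => ih _ _
    · rw [Set.indicator_of_notMem (by exact hν)]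
      exact integral_outputCorr_step_nonpos hn hρ0 hρ hh m (not_lt.1 hν)

/-! ### Gaussian estimates -/

theorem exp_le_gaussianPDFReal {w y B : ℝ} (h : |y - w| ≤ B) :
    Real.exp (-(B ^ 2 / 2)) / 3 ≤ gaussianPDFReal w 1 y := by
  rw [gaussianPDFReal, div_eq_inv_mul]
  have hB : (y - w) ^ 2 ≤ B ^ 2 := sq_le_sq' (abs_le.1 h).1 (abs_le.1 h).2
  have h3 : √(2 * Real.pi * (1 : NNReal)) ≤ 3 := by
    rw [Real.sqrt_le_left (by norm_num)]
    have := Real.pi_lt_d2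
    simp only [NNReal.coe_one, mul_one]
    nlinarith
  have hpos : 0 < √(2 * Real.pi * (1 : NNReal)) := by
    have := Real.pi_pos
    simp only [NNReal.coe_one, mul_one]
    positivity
  gcongr
  simp only [NNReal.coe_one, mul_one]
  linarith

theorem le_gaussianReal_Icc {w a b B : ℝ} (hab : a ≤ b) (h : ∀ y ∈ Set.Icc a b, |y - w| ≤ B) :
    (b - a) * (Real.exp (-(B ^ 2 / 2)) / 3) ≤ (gaussianReal w 1).real (Set.Icc a b) := by
  have h0 : 0 ≤ ∫ y in Set.Icc a b, gaussianPDFReal w 1 y :=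
    integral_nonneg fun y => gaussianPDFReal_nonneg _ _ _
  rw [Measure.real, gaussianReal_apply_eq_integral w one_ne_zero, ENNReal.toReal_ofReal h0]
  calc (b - a) * (Real.exp (-(B ^ 2 / 2)) / 3)
      = ∫ _ in Set.Icc a b, Real.exp (-(B ^ 2 / 2)) / 3 := by
        rw [setIntegral_const, Real.volume_real_Icc_of_le hab, smul_eq_mul]
    _ ≤ _ := setIntegral_mono_on (integrableOn_const (by simp))
        (integrable_gaussianPDFReal _ _).integrableOn measurableSet_Icc
        fun y hy => exp_le_gaussianPDFReal (h y hy)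

theorem le_gaussianReal_abs_le {w a B : ℝ} (ha : 0 ≤ a) (h : |w| + a ≤ B) :
    2 * a * (Real.exp (-(B ^ 2 / 2)) / 3) ≤ (gaussianReal w 1).real {y | |y| ≤ a} := by
  have hs : {y : ℝ | |y| ≤ a} = Set.Icc (-a) a := 
    Set.ext fun y => (abs_le : |y| ≤ a ↔ -a ≤ y ∧ y ≤ a)
  rw [hs, two_mul, ← sub_neg_eq_add a a]
  refine le_gaussianReal_Icc (by linarith) fun y hy => ?_
  have : |y| ≤ a := abs_le.2 hy
  linarith [abs_sub y w]

/-- An interval of length 1 beyond w ± a, on the side of w away from 0, gives a bound uniform in w.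
-/
theorem le_gaussianReal_le_abs (w : ℝ) {a : ℝ} (ha : 0 ≤ a) :
    Real.exp (-((a + 1) ^ 2 / 2)) / 3 ≤ (gaussianReal w 1).real {x | a ≤ |x|} := by
  rcases le_total 0 w with hw | hw
  · have h := le_gaussianReal_Icc (w := w) (a := w + a) (b := w + (a + 1)) (B := a + 1)
      (by linarith) fun y hy => abs_le.2 ⟨by linarith [hy.1], by linarith [hy.2]⟩
    rw [show w + (a + 1) - (w + a) = 1 by ring, one_mul] at h
    exact h.trans (measureReal_mono fun y hy =>
      show a ≤ |y| from le_abs.2 (Or.inl (by linarith [hy.1])))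
  · have h := le_gaussianReal_Icc (w := w) (a := w - (a + 1)) (b := w - a) (B := a + 1)
      (by linarith) fun y hy => abs_le.2 ⟨by linarith [hy.1], by linarith [hy.2]⟩
    rw [show w - a - (w - (a + 1)) = 1 by ring, one_mul] at h
    exact h.trans (measureReal_mono fun y hy =>
      show a ≤ |y| from le_abs.2 (Or.inr (by linarith [hy.2])))

theorem gaussianReal_abs_sub_lt_two (w : ℝ) :
    3 / 4 ≤ (gaussianReal w 1).real {x | |x - w| < 2} := by
  have h := meas_ge_le_variance_div_sq (memLp_id_gaussianReal (μ := w) (v := 1) 2)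
    (c := 2) (by norm_num)
  rw [variance_id_gaussianReal] at h
  simp only [id, integral_id_gaussianReal, NNReal.coe_one] at h
  have h' : (gaussianReal w 1).real {x | 2 ≤ |x - w|} ≤ 1 / 4 := by
    refine ENNReal.toReal_le_of_le_ofReal (by norm_num) (h.trans (le_of_eq ?_))
    norm_num
  have hc : {x : ℝ | |x - w| < 2} = {x | 2 ≤ |x - w|}ᶜ := by ext x; simp
  rw [hc, probReal_compl_eq_one_sub (measurableSet_le (by fun_prop) (by fun_prop))]
  linarith

theorem gaussianReal_tail {a : ℝ} (ha : 0 ≤ a) :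
    (gaussianReal 0 1).real {x | a ≤ |x|} ≤ 2 * Real.exp (-(a ^ 2 / 2)) := by
  have h1 : (gaussianReal 0 1).real {x | a ≤ x} ≤ Real.exp (-(a ^ 2 / 2)) := by
    refine (measure_ge_le_exp_mul_mgf (X := id) (μ := gaussianReal 0 1) a ha
      (integrable_exp_mul_gaussianReal a)).trans (le_of_eq ?_)
    rw [mgf_id_gaussianReal, ← Real.exp_add]
    congr 1
    simp only [NNReal.coe_one]
    ring
  have h2 : (gaussianReal 0 1).real {x | a ≤ -x} = (gaussianReal 0 1).real {x | a ≤ x} := by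
    have hneg : gaussianReal 0 1 = (gaussianReal 0 1).map fun x => -x := by
      rw [gaussianReal_map_neg, neg_zero]
    conv_rhs => rw [hneg]
    rw [map_measureReal_apply (by fun_prop) (measurableSet_le (by fun_prop) (by fun_prop))]
    rfl
  have hs : {x : ℝ | a ≤ |x|} ⊆ {x | a ≤ x} ∪ {x | a ≤ -x} := fun x hx =>
    (le_abs.1 (show a ≤ |x| from hx) : a ≤ x ∨ a ≤ -x)
  calc (gaussianReal 0 1).real {x | a ≤ |x|}
      ≤ (gaussianReal 0 1).real {x | a ≤ x} + (gaussianReal 0 1).real {x | a ≤ -x} :=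
        (measureReal_mono hs).trans (measureReal_union_le _ _)
    _ ≤ _ := by rw [h2]; linarith

/-! ### Lower bounds for `g` -/

/-- The threshold A decouples X from Y. It is taken to be 1 for a bound valid for every w, and
`pushConst` for the growth step. -/
theorem mul_le_gProb (w : ℝ × ℝ) (v A : ℝ) (hv : v ∈ Set.Icc (0 : ℝ) 1) :
    (gaussianReal w.1 1).real {x | A ≤ |x|} * (gaussianReal w.2 1).real {y | |y| ≤ A * √v} ≤
      gProb w v := by
  rw [← measureReal_prod_prod, gProb]
  refine measureReal_mono fun p hp => ?_
  have h1 : A ≤ |p.1| := hp.1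
  have h2 : |p.2| ≤ A * √v := hp.2
  have h3 : √(1 - v) ≤ 1 := by
    rw [Real.sqrt_le_one]
    linarith [hv.1]
  calc √(1 - v) * |p.2| ≤ 1 * |p.2| := by gcongr
    _ ≤ A * √v := by rw [one_mul]; exact h2
    _ ≤ √v * |p.1| := by rw [mul_comm]; gcongr

theorem gProb_lower_bound (w : ℝ × ℝ) {v : ℝ} (hv : v ∈ Set.Icc (0 : ℝ) 1) :
    2 * Real.exp (-3) / 9 * √v * Real.exp (-w.2 ^ 2) ≤ gProb w v := by
  have hv1 : √v ≤ 1 := by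
    rw [Real.sqrt_le_one]
    exact hv.2
  have hX := le_gaussianReal_le_abs w.1 zero_le_one
  have hY := le_gaussianReal_abs_le (w := w.2) (a := 1 * √v) (B := |w.2| + 1) (by positivity)
    (by linarith)
  refine le_trans ?_ (mul_le_gProb w v 1 hv)
  refine le_trans ?_ (mul_le_mul hX hY (by positivity) measureReal_nonneg)
  -- The exponents are 2 and (|w₂|+1)²/2 ≤ w₂² + 1, which together give 3 + w₂².
  have he : Real.exp (-3) * Real.exp (-w.2 ^ 2) ≤
      Real.exp (-((1 + 1) ^ 2 / 2)) * Real.exp (-((|w.2| + 1) ^ 2 / 2)) := by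
    rw [← Real.exp_add, ← Real.exp_add, Real.exp_le_exp]
    have := sq_abs w.2
    nlinarith [sq_nonneg (|w.2| - 1)]
  calc 2 * Real.exp (-3) / 9 * √v * Real.exp (-w.2 ^ 2)
      = 2 / 9 * √v * (Real.exp (-3) * Real.exp (-w.2 ^ 2)) := by ring
    _ ≤ 2 / 9 * √v *
        (Real.exp (-((1 + 1) ^ 2 / 2)) * Real.exp (-((|w.2| + 1) ^ 2 / 2))) := by gcongr
    _ = _ := by ring

/-- The size of `w₁` used to push the disagreement up. -/
def pushConst : ℝ := 8 * Real.exp 8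

theorem eight_le_pushConst : 8 ≤ pushConst := by
  have := Real.one_le_exp (show (0 : ℝ) ≤ 8 by norm_num)
  unfold pushConst
  linarith

theorem three_quarters_mul_le_gProb {w : ℝ × ℝ} {v : ℝ} (hv : v ∈ Set.Icc (0 : ℝ) 1)
    (h1 : pushConst + 2 ≤ |w.1|) :
    3 / 4 * (gaussianReal w.2 1).real {y | |y| ≤ pushConst * √v} ≤ gProb w v := by
  refine le_trans ?_ (mul_le_gProb w v pushConst hv)
  gcongr
  refine (gaussianReal_abs_sub_lt_two w.1).trans (measureReal_mono fun x hx => ?_)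
  have hx : |x - w.1| < 2 := hx
  have := abs_sub_abs_le_abs_sub w.1 x
  rw [abs_sub_comm] at this
  simp only [Set.mem_ofPred_eq]
  linarith

/-- Each of |X| ≥ `pushConst` and |Y| ≤ 3 has probability at least 3/4, and 9/16 ≥ 1/2. -/
theorem half_le_gProb {w : ℝ × ℝ} {v : ℝ} (hv : v ∈ Set.Icc (0 : ℝ) 1)
    (h1 : pushConst + 2 ≤ |w.1|) (h2 : |w.2| ≤ 1) (h3 : 3 ≤ pushConst * √v) :
    1 / 2 ≤ gProb w v := by
  refine le_trans ?_ (three_quarters_mul_le_gProb hv h1)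
  have : 3 / 4 ≤ (gaussianReal w.2 1).real {y | |y| ≤ pushConst * √v} := by
    refine (gaussianReal_abs_sub_lt_two w.2).trans (measureReal_mono fun y hy => ?_)
    have hy : |y - w.2| < 2 := hy
    have := abs_sub_abs_le_abs_sub y w.2
    simp only [Set.mem_ofPred_eq]
    linarith
  linarith

/-- This drives the growth v ↦ √v: the factor 4 pays for the binomial bound, which only guarantees n
g/4 disagreements. -/
theorem four_mul_sqrt_le_gProb {w : ℝ × ℝ} {v : ℝ} (hv : v ∈ Set.Icc (0 : ℝ) 1)
    (h1 : pushConst + 2 ≤ |w.1|) (h2 : |w.2| ≤ 1) (hg : gProb w v < 1 / 2) :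
    4 * √v ≤ gProb w v := by
  have h3 : pushConst * √v < 3 := by
    by_contra h
    exact hg.not_ge (half_le_gProb hv h1 h2 (not_lt.1 h))
  have hpos := eight_le_pushConst
  refine le_trans ?_ (three_quarters_mul_le_gProb hv h1)
  -- B = 4 bounds |w₂| + `pushConst`·√v < 1 + 3, so the density costs e⁻⁸; the value 8e⁸ of
  -- `pushConst` is chosen to compensate exactly.
  have hY := le_gaussianReal_abs_le (w := w.2) (a := pushConst * √v) (B := 4) (by positivity)
    (by linarith)
  have he : Real.exp 8 * Real.exp (-(4 ^ 2 / 2)) = 1 := by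
    rw [← Real.exp_add]
    norm_num
  calc 4 * √v = 4 * √v * (Real.exp 8 * Real.exp (-(4 ^ 2 / 2))) := by rw [he, mul_one]
    _ = 3 / 4 * (2 * (pushConst * √v) * (Real.exp (-(4 ^ 2 / 2)) / 3)) := by
      rw [pushConst]; ring
    _ ≤ _ := by gcongr

theorem gProb_one (w : ℝ × ℝ) : gProb w 1 = 1 := by
  simp [gProb]

/-! ### The number of disagreements after one layer -/

theorem integral_signBernoulli {p : ℝ} (h0 : 0 ≤ p) (h1 : p ≤ 1) (G : ℤˣ → ℝ) :
    ∫ u, G u ∂signBernoulli p = p * G 1 + (1 - p) * G (-1) := by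
  have := isProbabilityMeasure_signBernoulli h0 h1
  rw [integral_fintype Integrable.of_finite]
  have : (Finset.univ : Finset ℤˣ) = {1, -1} := rfl
  rw [this, Finset.sum_pair (by decide), signBernoulli_real_singleton h0 h1,
    signBernoulli_real_singleton h0 h1]
  simp only [signVal_one, signVal_neg_one, smul_eq_mul]
  ring

/-- Exponential Markov for the number D of negative signs: E 2^(-D) = (1-g/2)^n ≤ exp(-ng/2), while
D < ng/4 forces 2^(-D) ≥ exp(-ng/4). The factor (3+u)/4 is 1 or 1/2 according to the sign u. -/
theorem cubeBernoulli_few_negative {n : ℕ} {g : ℝ} (h0 : 0 ≤ g) (h1 : g ≤ 1) :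
    (cubeBernoulli n (1 - g)).real {z | ((disagree z 1).card : ℝ) < n * g / 4} ≤
      Real.exp (-(n * g / 4)) := by
  have := isProbabilityMeasure_signBernoulli (p := 1 - g) (by linarith) (by linarith)
  have := isProbabilityMeasure_cubeBernoulli n (p := 1 - g) (by linarith) (by linarith)
  have hint : ∫ z : Cube n, ∏ i, ((3 + signVal (z i)) / 4) ∂cubeBernoulli n (1 - g) =
      (1 - g / 2) ^ n := by
    rw [cubeBernoulli, integral_fintype_prod_eq_prod (𝕜 := ℝ) (fun _ u => (3 + signVal u) / 4)]
    rw [Finset.prod_const, integral_signBernoulli (by linarith) (by linarith)]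
    simp only [signVal_one, signVal_neg_one, Finset.card_univ, Fintype.card_fin]
    congr 1
    ring
  have hval : ∀ z : Cube n, ∏ i, ((3 + signVal (z i)) / 4) =
      (1 / 2 : ℝ) ^ (disagree z 1).card := by
    intro z
    rw [disagree, ← Finset.prod_const, Finset.prod_filter]
    refine Finset.prod_congr rfl fun i _ => ?_
    rcases Int.units_eq_one_or (z i) with h | h
    · simp only [h, Pi.one_apply, ne_eq, not_true_eq_false, if_false, signVal_one]
      norm_num
    · have : (-1 : ℤˣ) ≠ 1 := by decide
      simp only [h, Pi.one_apply, ne_eq, this, not_false_eq_true, if_true, signVal_neg_one]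
      norm_num
  have hmarkov := mul_meas_ge_le_integral_of_nonneg (μ := cubeBernoulli n (1 - g))
    (f := fun z => ∏ i, ((3 + signVal (z i)) / 4))
    (ae_of_all _ fun z => show 0 ≤ ∏ i, ((3 + signVal (z i)) / 4) by rw [hval]; positivity) Integrable.of_finite (Real.exp (-(n * g / 4)))
  rw [hint] at hmarkov
  have hsub : {z : Cube n | ((disagree z 1).card : ℝ) < n * g / 4} ⊆
      {z | Real.exp (-(n * g / 4)) ≤ ∏ i, ((3 + signVal (z i)) / 4)} := by
    intro z hz
    simp only [Set.mem_ofPred_eq] at hz ⊢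
    rw [hval]
    have hhalf : Real.exp (-1) ≤ 1 / 2 := by
      rw [Real.exp_neg, ← one_div]
      gcongr
      linarith [Real.add_one_le_exp (1 : ℝ)]
    calc Real.exp (-(n * g / 4)) ≤ Real.exp (-((disagree z 1).card : ℝ)) := by gcongr
      _ = Real.exp (-1) ^ (disagree z 1).card := by
        rw [← Real.exp_nat_mul]; congr 1; ring
      _ ≤ _ := by gcongr
  have hpow : (1 - g / 2) ^ n ≤ Real.exp (-(n * g / 4)) * Real.exp (-(n * g / 4)) := by
    calc (1 - g / 2) ^ n ≤ Real.exp (-(g / 2)) ^ n := by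
          gcongr
          · linarith
          · exact Real.one_sub_le_exp_neg _
      _ = _ := by
          rw [← Real.exp_nat_mul, ← Real.exp_add]; congr 1; ring
  have h2 := (mul_le_mul_of_nonneg_left (measureReal_mono (μ := cubeBernoulli n (1 - g)) hsub)
    (Real.exp_pos _).le).trans (hmarkov.trans hpow)
  exact le_of_mul_le_mul_left h2 (Real.exp_pos _)

theorem disagree_mul_one {n : ℕ} (x y : Cube n) : disagree (x * y) 1 = disagree x y := by
  ext i
  simp only [disagree, Finset.mem_filter, Finset.mem_univ, true_and, Pi.mul_apply, Pi.one_apply]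
  rcases Int.units_eq_one_or (x i) with h | h <;> rcases Int.units_eq_one_or (y i) with h' | h' <;>
    simp [h, h']

theorem privateLaw_few_disagree {n : ℕ} (hn : n ≠ 0) {ρ : ℝ} (hρ0 : 0 ≤ ρ) (hρ : ρ < 1)
    (ν : Fin n → ℝ) (x y : Cube n) :
    (privateLaw n).real {ψ | ((disagree (step ρ (ν, ψ) x) (step ρ (ν, ψ) y)).card : ℝ) <
        n * flipProb ρ ν x y / 4} ≤ Real.exp (-(n * flipProb ρ ν x y / 4)) := by
  have hms : Measurable fun ψ : Fin n → Fin n → ℝ => step ρ (ν, ψ) x * step ρ (ν, ψ) y :=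
    (measurable_of_countable fun p : Cube n × Cube n => p.1 * p.2).comp
      ((measurable_step_pair ρ x y).comp (measurable_const.prodMk measurable_id))
  have h := cubeBernoulli_few_negative (n := n) (gProb_nonneg (wVec ρ ν x y) (disagreeFrac x y))
    (gProb_le_one _ _)
  rw [← map_step_mul_step hn hρ0 hρ ν x y,
    map_measureReal_apply hms (Set.toFinite _).measurableSet] at h
  simp only [Set.preimage, Set.mem_ofPred_eq, disagree_mul_one] at h
  exact h

theorem disagreeFrac_mem_Icc {n : ℕ} (x y : Cube n) : disagreeFrac x y ∈ Set.Icc (0 : ℝ) 1 := by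
  refine ⟨by unfold disagreeFrac; positivity, div_le_one_of_le₀ ?_ (by positivity)⟩
  exact_mod_cast (Finset.card_le_univ _).trans_eq (Fintype.card_fin n)

theorem card_disagree_pos_iff {n : ℕ} {x y : Cube n} : 0 < (disagree x y).card ↔ x ≠ y := by
  rw [Finset.card_pos, disagree, Function.ne_iff]
  constructor
  · rintro ⟨i, hi⟩
    exact ⟨i, (Finset.mem_filter.1 hi).2⟩
  · rintro ⟨i, hi⟩
    exact ⟨i, Finset.mem_filter.2 ⟨Finset.mem_univ _, hi⟩⟩

theorem inv_le_disagreeFrac {n : ℕ} {x y : Cube n} (hxy : x ≠ y) :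
    1 / (n : ℝ) ≤ disagreeFrac x y := by
  unfold disagreeFrac
  gcongr
  exact_mod_cast card_disagree_pos_iff.2 hxy

/-! ### The shared Gaussian sums -/

theorem map_normalized_signedSum {n : ℕ} {s : Finset (Fin n)} (hs : s.Nonempty)
    (hs' : sᶜ.Nonempty) (x : Cube n) :
    (stdGaussianPi n).map (fun ν => (signedSum s x ν / √(s.card : ℝ),
      signedSum sᶜ x ν / √(sᶜ.card : ℝ))) = (gaussianReal 0 1).prod (gaussianReal 0 1) := by
  have hsc : ∀ {t : Finset (Fin n)}, t.Nonempty →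
      (gaussianReal 0 t.card).map (fun r => r / √(t.card : ℝ)) = gaussianReal 0 1 := by
    intro t ht
    have : (0 : ℝ) < t.card := by exact_mod_cast ht.card_pos
    rw [gaussianReal_map_div_const]
    congr 1
    · simp
    · ext
      simp [this.ne']
  have h := Measure.map_prod_map (gaussianReal 0 s.card) (gaussianReal 0 sᶜ.card)
    (f := fun r => r / √(s.card : ℝ)) (g := fun r => r / √(sᶜ.card : ℝ))
    (by fun_prop) (by fun_prop)
  rw [hsc hs, hsc hs', ← map_signedSum_prod s x, Measure.map_map (by fun_prop) (by fun_prop)] at h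
  exact h.symm

theorem wVec_eq {n : ℕ} (ρ : ℝ) (ν : Fin n → ℝ) (x y : Cube n) :
    wVec ρ ν x y = (√(ρ / (1 - ρ)) *
        (signedSum (disagree x y) x ν / √((disagree x y).card : ℝ)), √(ρ / (1 - ρ)) *
        (signedSum (disagree x y)ᶜ x ν / √((disagree x y)ᶜ.card : ℝ))) := by
  rw [card_compl_disagree]
  rfl

theorem flipProb_eq_one {n : ℕ} (hn : n ≠ 0) (ρ : ℝ) (ν : Fin n → ℝ) {x y : Cube n}
    (h : ¬(disagree x y)ᶜ.Nonempty) : flipProb ρ ν x y = 1 := by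
  have h1 : disagree x y = Finset.univ := by
    rw [Finset.not_nonempty_iff_eq_empty] at h
    simpa using h
  have h2 : disagreeFrac x y = 1 := by
    rw [disagreeFrac, h1]
    simp [hn]
  rw [flipProb, h2, gProb_one]

/-- The coordinates of W are normalised sums over disjoint nonempty sets, hence independent centred
Gaussians of variance ρ/(1-ρ). -/
theorem stdGaussianPi_real_wVec {n : ℕ} (ρ : ℝ) {x y : Cube n} (hxy : x ≠ y)
    (hxy' : (disagree x y)ᶜ.Nonempty) {A B : Set ℝ} (hA : MeasurableSet A)
    (hB : MeasurableSet B) :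
    (stdGaussianPi n).real {ν | (wVec ρ ν x y).1 ∈ A ∧ (wVec ρ ν x y).2 ∈ B} =
      (gaussianReal 0 1).real {r | √(ρ / (1 - ρ)) * r ∈ A} *
        (gaussianReal 0 1).real {r | √(ρ / (1 - ρ)) * r ∈ B} := by
  have hA' : MeasurableSet {r : ℝ | √(ρ / (1 - ρ)) * r ∈ A} :=
    (measurable_const_mul _) hA
  have hB' : MeasurableSet {r : ℝ | √(ρ / (1 - ρ)) * r ∈ B} :=
    (measurable_const_mul _) hB
  rw [← measureReal_prod_prod,
    ← map_normalized_signedSum (Finset.card_pos.1 (card_disagree_pos_iff.2 hxy)) hxy' x,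
    map_measureReal_apply (by fun_prop) (hA'.prod hB')]
  simp only [wVec_eq]
  rfl

/-! ### Bounds for the killed chain -/

theorem integrable_private {n : ℕ} (ρ : ℝ) (φ : Cube n × Cube n → ℝ) (ν : Fin n → ℝ)
    (x y : Cube n) :
    Integrable (fun ψ => φ (step ρ (ν, ψ) x, step ρ (ν, ψ) y)) (privateLaw n) :=
  (Integrable.of_finite (f := φ) (μ := (privateLaw n).map fun ψ =>
    (step ρ (ν, ψ) x, step ρ (ν, ψ) y))).comp_measurable
      ((measurable_step_pair ρ x y).comp (measurable_const.prodMk measurable_id))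

theorem killOp_le_integral {n : ℕ} {ρ : ℝ} {φ : Cube n × Cube n → ℝ} {x y : Cube n}
    {F : (Fin n → ℝ) → ℝ} (hF : Integrable F (stdGaussianPi n)) (hF0 : ∀ ν, 0 ≤ F ν)
    (h : ∀ ν, flipProb ρ ν x y < 1 / 2 →
      ∫ ψ, φ (step ρ (ν, ψ) x, step ρ (ν, ψ) y) ∂privateLaw n ≤ F ν) :
    killOp ρ φ (x, y) ≤ ∫ ν, F ν ∂stdGaussianPi n := by
  have hi := integrable_step_pair ρ φ x y Set.univ
  rw [Measure.restrict_univ, layerLaw_eq] at hi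
  have hS : MeasurableSet {ν : Fin n → ℝ | flipProb ρ ν x y < 1 / 2} :=
    measurableSet_lt (measurable_flipProb ρ x y) measurable_const
  rw [killOp_eq_integral_integral]
  refine (setIntegral_mono_on hi.integral_prod_left.integrableOn hF.integrableOn hS
    fun ν hν => h ν hν).trans ?_
  exact setIntegral_le_integral hF (ae_of_all _ hF0)

/-- Opposite inputs have g = 1 and are killed at once; this settles the case in which W₂ is an empty
sum. -/
theorem killOp_eq_zero {n : ℕ} (hn : n ≠ 0) (ρ : ℝ) (φ : Cube n × Cube n → ℝ) {x y : Cube n}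
    (h : ¬(disagree x y)ᶜ.Nonempty) : killOp ρ φ (x, y) = 0 := by
  have : {ν : Fin n → ℝ | flipProb ρ ν x y < 1 / 2} = ∅ := by
    ext ν
    simp only [flipProb_eq_one hn ρ ν h, Set.mem_ofPred_eq, Set.mem_empty_iff_false, iff_false]
    norm_num
  rw [killOp_eq_integral_integral, this, setIntegral_empty]

/-- The indicator of the pairs of equal inputs. -/
def diagInd {n : ℕ} (p : Cube n × Cube n) : ℝ := if p.1 = p.2 then 1 else 0

theorem diagInd_nonneg {n : ℕ} (p : Cube n × Cube n) : 0 ≤ diagInd p := by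
  unfold diagInd; split_ifs <;> norm_num

theorem integral_diagInd_le {n : ℕ} (hn : n ≠ 0) {ρ : ℝ} (hρ0 : 0 ≤ ρ) (hρ : ρ < 1)
    (ν : Fin n → ℝ) (x y : Cube n) (hg : 0 < flipProb ρ ν x y) :
    ∫ ψ, diagInd (step ρ (ν, ψ) x, step ρ (ν, ψ) y) ∂privateLaw n ≤
      Real.exp (-(n * flipProb ρ ν x y / 4)) := by
  have hm : MeasurableSet {ψ : Fin n → Fin n → ℝ | step ρ (ν, ψ) x = step ρ (ν, ψ) y} := by
    have hd : MeasurableSet {p : Cube n × Cube n | p.1 = p.2} := (Set.toFinite _).measurableSet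
    exact ((measurable_step_pair ρ x y).comp (measurable_const.prodMk measurable_id)) hd
  have h1 : ∫ ψ, diagInd (step ρ (ν, ψ) x, step ρ (ν, ψ) y) ∂privateLaw n =
      (privateLaw n).real {ψ | step ρ (ν, ψ) x = step ρ (ν, ψ) y} := by
    rw [← integral_indicator_one hm]
    refine integral_congr_ae (ae_of_all _ fun ψ => ?_)
    by_cases h : step ρ (ν, ψ) x = step ρ (ν, ψ) y
    · simp [diagInd, h]
    · simp [diagInd, h]
  rw [h1]
  refine (measureReal_mono fun ψ hψ => ?_).trans (privateLaw_few_disagree hn hρ0 hρ ν x y)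
  have hψ : step ρ (ν, ψ) x = step ρ (ν, ψ) y := hψ
  have hn' : (0 : ℝ) < n := by positivity
  simp only [Set.mem_ofPred_eq, hψ, disagree, ne_eq, not_true_eq_false, Finset.filter_false,
    Finset.card_empty, Nat.cast_zero]
  positivity

theorem measurable_wVec {n : ℕ} (ρ : ℝ) (x y : Cube n) :
    Measurable fun ν => wVec ρ ν x y := by
  unfold wVec; fun_prop

/-- It is unlikely that two different inputs are merged before `g ≥ 1/2`. -/
theorem killOp_diagInd_le {n : ℕ} (hn : n ≠ 0) {ρ : ℝ} (hρ0 : 0 < ρ) (hρ : ρ < 1)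
    {x y : Cube n} (hxy : x ≠ y) {K : ℝ} (hK : 0 ≤ K) :
    killOp ρ diagInd (x, y) ≤ 2 * Real.exp (-(K ^ 2 / 2)) +
      Real.exp (-(n * (2 * Real.exp (-3) / 9 * √(1 / n) *
        Real.exp (-(ρ / (1 - ρ) * K ^ 2))) / 4)) := by
  by_cases hxy' : (disagree x y)ᶜ.Nonempty
  swap
  · rw [killOp_eq_zero hn ρ _ hxy']
    positivity
  have hR : 0 < ρ / (1 - ρ) := div_pos hρ0 (by linarith)
  have hn' : (0 : ℝ) < n := by positivity
  set B : Set ℝ := {t | √(ρ / (1 - ρ)) * K ≤ |t|} with hB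
  have hBm : MeasurableSet B := measurableSet_le measurable_const (by fun_prop)
  -- The exceptional event that |W₂| is at least K standard deviations. Outside it, g is bounded
  -- below using v ≥ 1/n.
  set E : Set (Fin n → ℝ) := {ν | (wVec ρ ν x y).1 ∈ Set.univ ∧ (wVec ρ ν x y).2 ∈ B} with hE
  have hEm : MeasurableSet E := (measurable_wVec ρ x y) (MeasurableSet.univ.prod hBm)
  have hPE : (stdGaussianPi n).real E ≤ 2 * Real.exp (-(K ^ 2 / 2)) := by
    rw [hE, stdGaussianPi_real_wVec ρ hxy hxy' MeasurableSet.univ hBm]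
    have hset : {r | √(ρ / (1 - ρ)) * r ∈ B} = {r : ℝ | K ≤ |r|} := by
      ext r
      simp only [hB, Set.mem_ofPred_eq, abs_mul, abs_of_nonneg (Real.sqrt_nonneg _)]
      exact mul_le_mul_iff_right₀ (Real.sqrt_pos.2 hR)
    rw [hset]
    calc _ ≤ 1 * (gaussianReal 0 1).real {r : ℝ | K ≤ |r|} := by
          gcongr
          exact measureReal_le_one
      _ ≤ _ := by rw [one_mul]; exact gaussianReal_tail hK
  set e := Real.exp (-(n * (2 * Real.exp (-3) / 9 * √(1 / n) *
        Real.exp (-(ρ / (1 - ρ) * K ^ 2))) / 4)) with he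
  have hint : Integrable (fun ν => E.indicator (fun _ => (1 : ℝ)) ν + e) (stdGaussianPi n) :=
    ((integrable_const _).indicator hEm).add (integrable_const _)
  have hind0 : ∀ ν, 0 ≤ E.indicator (fun _ => (1 : ℝ)) ν := fun ν =>
    Set.indicator_nonneg (fun _ _ => zero_le_one) ν
  refine (killOp_le_integral hint (fun ν => add_nonneg (hind0 ν) (Real.exp_pos _).le)
    fun ν _ => ?_).trans ?_
  · by_cases hν : ν ∈ E
    · rw [Set.indicator_of_mem hν]
      have : ∫ ψ, diagInd (step ρ (ν, ψ) x, step ρ (ν, ψ) y) ∂privateLaw n ≤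
          ∫ _, (1 : ℝ) ∂privateLaw n := by
        refine integral_mono (integrable_private ρ diagInd ν x y) (integrable_const _) fun ψ => ?_
        unfold diagInd
        split_ifs <;> norm_num
      rw [integral_const, probReal_univ, one_smul] at this
      linarith [Real.exp_pos (-(n * (2 * Real.exp (-3) / 9 * √(1 / n) *
        Real.exp (-(ρ / (1 - ρ) * K ^ 2))) / 4))]
    · rw [Set.indicator_of_notMem hν, zero_add]
      have hw : |(wVec ρ ν x y).2| < √(ρ / (1 - ρ)) * K := by
        by_contra h
        exact hν ⟨trivial, not_lt.1 h⟩
      have hw2 : (wVec ρ ν x y).2 ^ 2 ≤ ρ / (1 - ρ) * K ^ 2 := by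
        rw [← sq_abs]
        calc _ ≤ (√(ρ / (1 - ρ)) * K) ^ 2 := by gcongr
          _ = _ := by rw [mul_pow, Real.sq_sqrt hR.le]
      have hg : 2 * Real.exp (-3) / 9 * √(1 / n) * Real.exp (-(ρ / (1 - ρ) * K ^ 2)) ≤
          flipProb ρ ν x y := by
        refine le_trans ?_ (gProb_lower_bound _ (disagreeFrac_mem_Icc x y))
        have := inv_le_disagreeFrac hxy
        gcongr
      refine (integral_diagInd_le hn hρ0.le hρ ν x y (lt_of_lt_of_le ?_ hg)).trans ?_
      · positivity
      · rw [he]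
        gcongr
  · rw [integral_add ((integrable_const _).indicator hEm) (integrable_const _), integral_const,
      probReal_univ, one_smul]
    have : ∫ ν, E.indicator (fun _ => (1 : ℝ)) ν ∂stdGaussianPi n = (stdGaussianPi n).real E :=
      integral_indicator_one hEm
    rw [this]
    linarith

/-- The probability that `|W₁|` is large and `|W₂| ≤ 1`. -/
def pushProb (R : ℝ) : ℝ :=
  (gaussianReal 0 1).real {r | pushConst + 2 ≤ |√R * r|} * (gaussianReal 0 1).real {r | |√R * r| ≤ 1}

theorem pushProb_nonneg (R : ℝ) : 0 ≤ pushProb R := mul_nonneg measureReal_nonneg measureReal_nonneg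

theorem pushProb_le_one (R : ℝ) : pushProb R ≤ 1 :=
  mul_le_one₀ measureReal_le_one measureReal_nonneg measureReal_le_one

/-- The shared vectors that push the disagreement up. -/
def pushSet {n : ℕ} (ρ : ℝ) (x y : Cube n) : Set (Fin n → ℝ) :=
  {ν | (wVec ρ ν x y).1 ∈ {t : ℝ | pushConst + 2 ≤ |t|} ∧
    (wVec ρ ν x y).2 ∈ {t : ℝ | |t| ≤ 1}}

theorem measurableSet_pushSet {n : ℕ} (ρ : ℝ) (x y : Cube n) :
    MeasurableSet (pushSet ρ x y) :=
  (measurable_wVec ρ x y) ((measurableSet_le measurable_const (by fun_prop)).prod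
    (measurableSet_le (by fun_prop) measurable_const))

theorem stdGaussianPi_real_pushSet {n : ℕ} (ρ : ℝ) {x y : Cube n} (hxy : x ≠ y)
    (hxy' : (disagree x y)ᶜ.Nonempty) :
    (stdGaussianPi n).real (pushSet ρ x y) = pushProb (ρ / (1 - ρ)) :=
  stdGaussianPi_real_wVec ρ hxy hxy' (measurableSet_le measurable_const (by fun_prop))
    (measurableSet_le (by fun_prop) measurable_const)

/-- Off the pushing set φ is bounded by 1; on it a gain c is available. The condition c ≤ 1 keeps
the majorant nonnegative, so the restriction to g < 1/2 can be dropped. -/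
theorem killOp_le_of_pushSet {n : ℕ} {ρ : ℝ} {φ : Cube n × Cube n → ℝ} {x y : Cube n}
    (hxy : x ≠ y) (hxy' : (disagree x y)ᶜ.Nonempty) (hφ : ∀ p, φ p ≤ 1) {c : ℝ} (hc : c ≤ 1)
    (h : ∀ ν ∈ pushSet ρ x y, flipProb ρ ν x y < 1 / 2 →
      ∫ ψ, φ (step ρ (ν, ψ) x, step ρ (ν, ψ) y) ∂privateLaw n ≤ 1 - c) :
    killOp ρ φ (x, y) ≤ 1 - pushProb (ρ / (1 - ρ)) * c := by
  set E := pushSet ρ x y with hE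
  have hEm : MeasurableSet E := measurableSet_pushSet ρ x y
  have hint : Integrable (fun ν => 1 - E.indicator (fun _ => c) ν) (stdGaussianPi n) :=
    (integrable_const _).sub ((integrable_const _).indicator hEm)
  refine (killOp_le_integral hint (fun ν => ?_) fun ν hg => ?_).trans (le_of_eq ?_)
  · by_cases hν : ν ∈ E
    · rw [Set.indicator_of_mem hν]; linarith
    · rw [Set.indicator_of_notMem hν]; norm_num
  · by_cases hν : ν ∈ E
    · rw [Set.indicator_of_mem hν]
      exact h ν hν hg
    · rw [Set.indicator_of_notMem hν, sub_zero]
      have : ∫ ψ, φ (step ρ (ν, ψ) x, step ρ (ν, ψ) y) ∂privateLaw n ≤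
          ∫ _, (1 : ℝ) ∂privateLaw n :=
        integral_mono (integrable_private ρ φ ν x y) (integrable_const _) fun ψ => hφ _
      rwa [integral_const, probReal_univ, one_smul] at this
  · rw [integral_sub (integrable_const _) ((integrable_const _).indicator hEm), integral_const,
      probReal_univ, one_smul, integral_indicator_const _ hEm, hE,
      stdGaussianPi_real_pushSet ρ hxy hxy', smul_eq_mul]

/-- From `D/n ≥ exp(-2^j)`, the level `g ≥ 1/2` is reached within `j + 1` layers with a probability
that is not too small. -/
theorem survProb_le_of_disagreeFrac {n : ℕ} (hn : n ≠ 0) {ρ : ℝ} (hρ0 : 0 < ρ) (hρ : ρ < 1)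
    (j : ℕ) {x y : Cube n} (hxy : x ≠ y) (hv : Real.exp (-(2 : ℝ) ^ j) ≤ disagreeFrac x y) :
    survProb ρ (j + 1) (x, y) ≤ 1 - (pushProb (ρ / (1 - ρ)) / 2) ^ (j + 1) := by
  have hq0 := pushProb_nonneg (ρ / (1 - ρ))
  have hq1 := pushProb_le_one (ρ / (1 - ρ))
  have hA := eight_le_pushConst
  have hn' : (0 : ℝ) < n := by positivity
  have hn1 : (1 : ℝ) ≤ n := by exact_mod_cast Nat.one_le_iff_ne_zero.2 hn
  induction j generalizing x y with
  | zero =>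
    rw [zero_add, survProb_succ, pow_one]
    by_cases hxy' : (disagree x y)ᶜ.Nonempty
    swap
    · rw [killOp_eq_zero hn ρ _ hxy']
      linarith
    refine (killOp_le_of_pushSet hxy hxy' (survProb_le_one ρ 0) le_rfl
      fun ν hν hg => ?_).trans (by linarith)
    refine absurd hg (not_lt.2 (half_le_gProb (disagreeFrac_mem_Icc x y) hν.1 hν.2 ?_))
    -- Here v ≥ 1/e ≥ 1/4, so `pushConst`·√v ≥ 4 and a push hits immediately.
    have hs : 1 / 2 ≤ √(disagreeFrac x y) := by
      refine Real.le_sqrt_of_sq_le (le_trans ?_ hv)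
      rw [pow_zero, Real.exp_neg, ← one_div, le_div_iff₀ (Real.exp_pos _)]
      linarith [Real.exp_one_lt_d9]
    nlinarith
  | succ j ih =>
    rw [survProb_succ]
    by_cases hxy' : (disagree x y)ᶜ.Nonempty
    swap
    · rw [killOp_eq_zero hn ρ _ hxy', sub_nonneg]
      exact pow_le_one₀ (by linarith) (by linarith)
    set b := (pushProb (ρ / (1 - ρ)) / 2) ^ (j + 1) with hb
    have hb0 : 0 ≤ b := by positivity
    have hb1 : b ≤ 1 := pow_le_one₀ (by linarith) (by linarith)
    refine (killOp_le_of_pushSet (c := 1 / 2 * b) hxy hxy' (survProb_le_one ρ (j + 1))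
      (by linarith) fun ν hν hg => ?_).trans (le_of_eq (by rw [pow_succ, ← hb]; ring))
    have hg4 := four_mul_sqrt_le_gProb (disagreeFrac_mem_Icc x y) hν.1 hν.2 hg
    set v := disagreeFrac x y with hvdef
    have hv0 : 0 < v := (Real.exp_pos _).trans_le hv
    set G : Set (Fin n → Fin n → ℝ) :=
      {ψ | ((disagree (step ρ (ν, ψ) x) (step ρ (ν, ψ) y)).card : ℝ) <
        n * flipProb ρ ν x y / 4} with hG
    have hGm : MeasurableSet G := by
      have hd : MeasurableSet {p : Cube n × Cube n | ((disagree p.1 p.2).card : ℝ) <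
        n * flipProb ρ ν x y / 4} := (Set.toFinite _).measurableSet
      exact ((measurable_step_pair ρ x y).comp (measurable_const.prodMk measurable_id)) hd
    have hnv : n * √v ≤ n * flipProb ρ ν x y / 4 := by
      have : 4 * √v ≤ flipProb ρ ν x y := hg4
      nlinarith
    have hnv1 : 1 ≤ n * √v := by
      have h1 : √(1 / (n : ℝ)) ≤ √v := Real.sqrt_le_sqrt (inv_le_disagreeFrac hxy)
      have h2 : 1 / (n : ℝ) ≤ √(1 / (n : ℝ)) := by
        refine Real.le_sqrt_of_sq_le ?_
        rw [sq]
        exact mul_le_of_le_one_left (by positivity) ((div_le_one hn').2 hn1)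
      calc (1 : ℝ) = n * (1 / n) := by field_simp
        _ ≤ n * √v := by gcongr; exact h2.trans h1
    have hPG : (privateLaw n).real G ≤ 1 / 2 := by
      refine (privateLaw_few_disagree hn hρ0.le hρ ν x y).trans ?_
      calc Real.exp (-(n * flipProb ρ ν x y / 4)) ≤ Real.exp (-1) := by
            rw [Real.exp_le_exp]; linarith
        _ ≤ 1 / 2 := by
            rw [Real.exp_neg, ← one_div]
            gcongr
            linarith [Real.add_one_le_exp (1 : ℝ)]
    have hpt : ∀ ψ, survProb ρ (j + 1) (step ρ (ν, ψ) x, step ρ (ν, ψ) y) ≤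
        1 - b + G.indicator (fun _ => b) ψ := by
      intro ψ
      by_cases hψ : ψ ∈ G
      · rw [Set.indicator_of_mem hψ]
        linarith [survProb_le_one ρ (j + 1) (step ρ (ν, ψ) x, step ρ (ν, ψ) y)]
      · rw [Set.indicator_of_notMem hψ, add_zero]
        have hcard : n * √v ≤ (disagree (step ρ (ν, ψ) x) (step ρ (ν, ψ) y)).card :=
          hnv.trans (not_lt.1 hψ)
        refine ih (card_disagree_pos_iff.1 ?_) ?_
        · exact_mod_cast (by linarith : (0 : ℝ) <
            (disagree (step ρ (ν, ψ) x) (step ρ (ν, ψ) y)).card)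
        · have h1 : Real.exp (-(2 : ℝ) ^ j) ≤ √v := by
            refine Real.le_sqrt_of_sq_le (le_trans (le_of_eq ?_) hv)
            rw [← Real.exp_nat_mul]
            congr 1
            push_cast
            ring
          rw [disagreeFrac, le_div_iff₀ hn', mul_comm]
          exact le_trans (by gcongr) hcard
    calc ∫ ψ, survProb ρ (j + 1) (step ρ (ν, ψ) x, step ρ (ν, ψ) y) ∂privateLaw n
        ≤ ∫ ψ, (1 - b + G.indicator (fun _ => b) ψ) ∂privateLaw n :=
          integral_mono (integrable_private ρ _ ν x y)
            ((integrable_const _).add ((integrable_const _).indicator hGm)) hpt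
      _ = 1 - b + (privateLaw n).real G * b := by
          rw [integral_add (integrable_const _) ((integrable_const _).indicator hGm),
            integral_const, probReal_univ, one_smul, integral_indicator_const _ hGm, smul_eq_mul]
      _ ≤ 1 - 1 / 2 * b := by nlinarith

/-! ### Blocks of layers -/

/-- A union bound over the layer at which the two states merge. -/
theorem iterate_killOp_diagInd_le {n : ℕ} {ρ η : ℝ} (hη : 0 ≤ η)
    (h : ∀ x y : Cube n, x ≠ y → killOp ρ diagInd (x, y) ≤ η) (m : ℕ) (p : Cube n × Cube n) :
    (killOp ρ)^[m] diagInd p ≤ m * η + diagInd p := by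
  induction m generalizing p with
  | zero => simp
  | succ m ih =>
    have hstep : killOp ρ diagInd p ≤ η + diagInd p := by
      by_cases hp : p.1 = p.2
      · have h1 : killOp ρ diagInd p ≤ 1 :=
          (killOp_mono ρ (fun q => by unfold diagInd; split_ifs <;> norm_num) p).trans
            (killOp_one_le_one ρ p)
        rw [show diagInd p = 1 from if_pos hp]
        linarith
      · exact (h p.1 p.2 hp).trans (by linarith [diagInd_nonneg p])
    have hconst : killOp ρ (fun _ : Cube n × Cube n => (m * η : ℝ)) p ≤ m * η := by
      have h1 := congrFun (killOp_const_mul ρ (m * η) fun _ : Cube n × Cube n => (1 : ℝ)) p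
      simp only [mul_one] at h1
      rw [h1]
      exact mul_le_of_le_one_right (by positivity) (killOp_one_le_one ρ p)
    rw [Function.iterate_succ_apply']
    refine (killOp_mono ρ ih p).trans ?_
    rw [congrFun (killOp_add ρ (fun _ => (m * η : ℝ)) diagInd) p]
    push_cast
    linarith

theorem iterate_killOp_mono {n : ℕ} (ρ : ℝ) (m : ℕ) {φ φ' : Cube n × Cube n → ℝ}
    (h : ∀ p, φ p ≤ φ' p) (p : Cube n × Cube n) :
    (killOp ρ)^[m] φ p ≤ (killOp ρ)^[m] φ' p := by
  induction m generalizing p with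
  | zero => exact h p
  | succ m ih =>
    rw [Function.iterate_succ_apply', Function.iterate_succ_apply']
    exact killOp_mono ρ ih p

theorem iterate_killOp_add_mul {n : ℕ} (ρ : ℝ) (m : ℕ) (φ φ' : Cube n × Cube n → ℝ) (c : ℝ) :
    (killOp ρ)^[m] (fun p => φ p + c * φ' p) =
      fun p => (killOp ρ)^[m] φ p + c * (killOp ρ)^[m] φ' p := by
  induction m with
  | zero => rfl
  | succ m ih =>
    rw [Function.iterate_succ_apply', ih, killOp_add, killOp_const_mul,
      Function.iterate_succ_apply', Function.iterate_succ_apply']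

theorem survProb_antitone {n : ℕ} (ρ : ℝ) (p : Cube n × Cube n) :
    Antitone fun m => survProb ρ m p := by
  refine antitone_nat_of_succ_le fun m => ?_
  rw [survProb, Function.iterate_succ_apply]
  exact iterate_killOp_mono ρ m (killOp_one_le_one ρ) p

/-- One block turns the bound s into kη + (1-b)s: merging within the block, or surviving it
unmerged. The fixed point kη/b makes the estimate uniform in the number of blocks. -/
theorem survProb_blocks_le {n : ℕ} {ρ η b : ℝ} (hη : 0 ≤ η) (hb0 : 0 < b) (hb1 : b ≤ 1) (k : ℕ)
    (hdiag : ∀ x y : Cube n, x ≠ y → killOp ρ diagInd (x, y) ≤ η)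
    (hhit : ∀ x y : Cube n, x ≠ y → survProb ρ k (x, y) ≤ 1 - b) (j : ℕ) {x y : Cube n}
    (hxy : x ≠ y) : survProb ρ (k * j) (x, y) ≤ (1 - b) ^ j + k * η / b := by
  induction j generalizing x y with
  | zero =>
    have : 0 ≤ k * η / b := by positivity
    simpa [survProb] using this
  | succ j ih =>
    set s := (1 - b) ^ j + k * η / b with hs
    have hs0 : 0 ≤ s := add_nonneg (pow_nonneg (by linarith) _) (by positivity)
    have hle : ∀ p : Cube n × Cube n, survProb ρ (k * j) p ≤ diagInd p + s * 1 := by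
      intro p
      by_cases hp : p.1 = p.2
      · rw [show diagInd p = 1 from if_pos hp]
        linarith [survProb_le_one ρ (k * j) p]
      · linarith [ih (x := p.1) (y := p.2) hp, diagInd_nonneg p]
    have h1 : survProb ρ (k * (j + 1)) (x, y) = (killOp ρ)^[k] (survProb ρ (k * j)) (x, y) := by
      rw [survProb, survProb, ← Function.iterate_add_apply, mul_add, mul_one, add_comm]
    rw [h1]
    refine (iterate_killOp_mono ρ k hle (x, y)).trans ?_
    rw [iterate_killOp_add_mul]
    have h2 := iterate_killOp_diagInd_le hη hdiag k (x, y)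
    rw [show diagInd (x, y) = 0 from if_neg hxy, add_zero] at h2
    have h3 : s * (killOp ρ)^[k] (fun _ => 1) (x, y) ≤ s * (1 - b) :=
      mul_le_mul_of_nonneg_left (hhit x y hxy) hs0
    have h4 : k * η + s * (1 - b) = (1 - b) ^ (j + 1) + k * η / b := by
      rw [hs, pow_succ]
      field_simp
      ring
    beta_reduce
    linarith

/-! ### Asymptotics of the survival probability -/

/-- R ≥ δ makes |W₁| large with probability bounded below; R ≤ ℓ makes |W₂| ≤ 1 with probability of
order 1/√ℓ. It is applied with ℓ = log n. -/
theorem le_pushProb {δ R ℓ : ℝ} (hδ : 0 < δ) (hR : δ ≤ R) (hRℓ : R ≤ ℓ) (hℓ : 1 ≤ ℓ) :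
    Real.exp (-(((pushConst + 2) / √δ + 1) ^ 2 / 2)) / 3 * (2 * Real.exp (-(1 / 2)) / 3) / √ℓ ≤
      pushProb R := by
  have hA := eight_le_pushConst
  have hsδ : 0 < √δ := Real.sqrt_pos.2 hδ
  have hsℓ : 1 ≤ √ℓ := Real.one_le_sqrt.2 hℓ
  have h1 : Real.exp (-(((pushConst + 2) / √δ + 1) ^ 2 / 2)) / 3 ≤
      (gaussianReal 0 1).real {r | pushConst + 2 ≤ |√R * r|} := by
    refine (le_gaussianReal_le_abs 0 (by positivity)).trans (measureReal_mono fun r hr => ?_)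
    have hr : (pushConst + 2) / √δ ≤ |r| := hr
    rw [div_le_iff₀ hsδ] at hr
    simp only [Set.mem_ofPred_eq, abs_mul, abs_of_nonneg (Real.sqrt_nonneg _)]
    calc pushConst + 2 ≤ √δ * |r| := by linarith
      _ ≤ √R * |r| := by gcongr
  have h2 : 2 * Real.exp (-(1 / 2)) / 3 / √ℓ ≤ (gaussianReal 0 1).real {r | |√R * r| ≤ 1} := by
    have h := le_gaussianReal_abs_le (w := 0) (a := 1 / √ℓ) (B := 1) (by positivity) (by
      rw [abs_zero, zero_add, div_le_one (by positivity)]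
      exact hsℓ)
    refine le_trans (le_of_eq ?_) (h.trans (measureReal_mono fun r hr => ?_))
    · norm_num
      ring
    · have hr : |r| ≤ 1 / √ℓ := hr
      rw [le_div_iff₀ (by positivity)] at hr
      simp only [Set.mem_ofPred_eq, abs_mul, abs_of_nonneg (Real.sqrt_nonneg _)]
      calc √R * |r| ≤ √ℓ * |r| := by gcongr
        _ ≤ 1 := by linarith
  rw [mul_div_assoc]
  exact mul_le_mul h1 h2 (by positivity) measureReal_nonneg

/-- Here L = log log n, so exp L = log n, and exp(-C) carries the constants of the push probability;
C ≤ L/2 leaves a push factor of at least exp(-L). -/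
theorem survProb_le_of_params {n T : ℕ} {ρ L C : ℝ} (hn : (n : ℝ) = Real.exp (Real.exp L))
    (hL : 8 ≤ L) (hC : C ≤ L / 2) (hρ0 : 0 < ρ) (hρ : ρ < 1)
    (hR : ρ / (1 - ρ) * L ^ 3 ≤ Real.exp L / 4)
    (hq : Real.exp (-C) / √(Real.exp L) ≤ pushProb (ρ / (1 - ρ)) / 2)
    (hlarge : L ^ 3 / 2 ≤ 2 * Real.exp (-3) / 9 / 4 * Real.exp (Real.exp L / 4))
    (hT : Real.exp (4 * L ^ 2) ≤ T) {x y : Cube n} (hxy : x ≠ y) :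
    survProb ρ (T - 1) (x, y) ≤ Real.exp (1 - L) + 6 * (L * Real.exp (-L)) := by
  have hn0 : n ≠ 0 := by
    rintro rfl
    exact (Real.exp_pos (Real.exp L)).ne' (by exact_mod_cast hn.symm)
  -- With 2^k ≤ log n < 2^(k+1), any distinct pair has v ≥ 1/n ≥ exp(-2^(k+1)), so a block of k + 2
  -- ≤ 2L layers suffices.
  obtain ⟨k, hk1, hk2⟩ := exists_nat_pow_near
    (Real.one_le_exp (show 0 ≤ L by linarith)) (one_lt_two : (1 : ℝ) < 2)
  have hK : ((k + 2 : ℕ) : ℝ) ≤ 2 * L := by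
    have h1 : (k : ℝ) * Real.log 2 ≤ L := by
      rw [← Real.log_pow]
      exact (Real.log_le_iff_le_exp (by positivity)).2 hk1
    have h2 := Real.log_two_gt_d9
    push_cast
    nlinarith [(Nat.cast_nonneg k : (0 : ℝ) ≤ k)]
  have hKpos : (0 : ℝ) < ((k + 2 : ℕ) : ℝ) := by positivity
  set b := Real.exp (-(2 * L ^ 2)) with hb
  have hb0 : 0 < b := Real.exp_pos _
  have hb1 : b ≤ 1 := Real.exp_le_one_iff.2 (by nlinarith)
  set η := 3 * Real.exp (-(L ^ 3 / 2)) with hη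
  have hhit : ∀ x y : Cube n, x ≠ y → survProb ρ (k + 2) (x, y) ≤ 1 - b := by
    intro x y hxy
    have hv : Real.exp (-(2 : ℝ) ^ (k + 1)) ≤ disagreeFrac x y := by
      refine le_trans ?_ (inv_le_disagreeFrac hxy)
      rw [hn, one_div, ← Real.exp_neg]
      gcongr
    refine (survProb_le_of_disagreeFrac hn0 hρ0 hρ (k + 1) hxy hv).trans ?_
    have hq' : Real.exp (-L) ≤ pushProb (ρ / (1 - ρ)) / 2 := by
      refine le_trans ?_ hq
      rw [← Real.exp_half, ← Real.exp_sub, Real.exp_le_exp]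
      linarith
    have : b ≤ (pushProb (ρ / (1 - ρ)) / 2) ^ (k + 2) := by
      calc b ≤ Real.exp (-L) ^ (k + 2) := by
            rw [← Real.exp_nat_mul, hb, Real.exp_le_exp]
            nlinarith
        _ ≤ _ := by gcongr
    linarith
  have hdiag : ∀ x y : Cube n, x ≠ y → killOp ρ diagInd (x, y) ≤ η := by
    intro x y hxy
    have hL3 : 0 ≤ L ^ 3 := by positivity
    -- K² = L³ makes the Gaussian tail negligible against b = exp(-2L²), while `hR` limits the loss
    -- in n g to n^(1/4), leaving order n^(1/4) of √n.
    have h := killOp_diagInd_le hn0 hρ0 hρ hxy (Real.sqrt_nonneg (L ^ 3))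
    rw [Real.sq_sqrt hL3] at h
    refine h.trans ?_
    have hbig : L ^ 3 / 2 ≤ n * (2 * Real.exp (-3) / 9 * √(1 / n) *
        Real.exp (-(ρ / (1 - ρ) * L ^ 3))) / 4 := by
      refine hlarge.trans ?_
      have hs : √(1 / (n : ℝ)) = Real.exp (-Real.exp L / 2) := by
        rw [hn, one_div, ← Real.exp_neg, Real.exp_half]
      have he : Real.exp (Real.exp L / 4) ≤
          n * √(1 / (n : ℝ)) * Real.exp (-(ρ / (1 - ρ) * L ^ 3)) := by
        rw [hs, hn, ← Real.exp_add, ← Real.exp_add, Real.exp_le_exp]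
        linarith
      calc 2 * Real.exp (-3) / 9 / 4 * Real.exp (Real.exp L / 4)
          ≤ 2 * Real.exp (-3) / 9 / 4 *
            (n * √(1 / (n : ℝ)) * Real.exp (-(ρ / (1 - ρ) * L ^ 3))) := by gcongr
        _ = _ := by ring
    have : Real.exp (-(n * (2 * Real.exp (-3) / 9 * √(1 / n) *
        Real.exp (-(ρ / (1 - ρ) * L ^ 3))) / 4)) ≤ Real.exp (-(L ^ 3 / 2)) := by
      rw [Real.exp_le_exp]; linarith
    rw [hη]
    linarith
  set j := (T - 1) / (k + 2) with hj
  have hmono : survProb ρ (T - 1) (x, y) ≤ survProb ρ ((k + 2) * j) (x, y) :=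
    survProb_antitone ρ (x, y) (Nat.mul_div_le _ _)
  have hblocks := survProb_blocks_le (by positivity : 0 ≤ η) hb0 hb1 (k + 2) hdiag hhit j hxy
  have hTj : (T : ℝ) ≤ 2 * L * (j + 1) := by
    have h1 : T ≤ (k + 2) * (j + 1) := by
      have := Nat.lt_mul_div_succ (T - 1) (show 0 < k + 2 by omega)
      rw [← hj] at this
      omega
    have h2 : (T : ℝ) ≤ ((k + 2 : ℕ) : ℝ) * (j + 1) := by exact_mod_cast h1
    exact h2.trans (by gcongr)
  -- Depth exp(4L²) holds enough blocks: b·exp(4L²) = exp(2L²) ≥ 2L², against at most 2L layers per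
  -- block.
  have hbj : L - 1 ≤ b * j := by
    have h1 : b * Real.exp (4 * L ^ 2) = Real.exp (2 * L ^ 2) := by
      rw [hb, ← Real.exp_add]; congr 1; ring
    have h2 : 2 * L ^ 2 + 1 ≤ Real.exp (2 * L ^ 2) := Real.add_one_le_exp _
    have h3 : b * Real.exp (4 * L ^ 2) ≤ b * (2 * L * (j + 1)) := by gcongr; exact hT.trans hTj
    have h4 : 2 * L * L ≤ 2 * L * (b * j + b) := by nlinarith
    have h5 := le_of_mul_le_mul_left h4 (by linarith)
    linarith
  have hpow : (1 - b) ^ j ≤ Real.exp (1 - L) := by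
    calc (1 - b) ^ j ≤ Real.exp (-b) ^ j := by
          gcongr
          exact Real.one_sub_le_exp_neg b
      _ = Real.exp (-(b * j)) := by rw [← Real.exp_nat_mul]; congr 1; ring
      _ ≤ _ := by rw [Real.exp_le_exp]; linarith
  have hrest : ((k + 2 : ℕ) : ℝ) * η / b ≤ 6 * (L * Real.exp (-L)) := by
    have h1 : Real.exp (-(L ^ 3 / 2)) / b ≤ Real.exp (-L) := by
      rw [hb, ← Real.exp_sub, Real.exp_le_exp]
      nlinarith [mul_nonneg (sq_nonneg L) (show 0 ≤ L - 8 by linarith)]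
    calc ((k + 2 : ℕ) : ℝ) * η / b
        = ((k + 2 : ℕ) : ℝ) * 3 * (Real.exp (-(L ^ 3 / 2)) / b) := by rw [hη]; ring
      _ ≤ 2 * L * 3 * Real.exp (-L) := by gcongr
      _ = _ := by ring
  linarith

theorem tendsto_log_log_nat : Tendsto (fun n : ℕ => Real.log (Real.log n)) atTop atTop :=
  Real.tendsto_log_atTop.comp (Real.tendsto_log_atTop.comp tendsto_natCast_atTop_atTop)

/-- The bound on the survival probability. -/
def survBound (n : ℕ) : ℝ :=
  Real.exp (1 - Real.log (Real.log n)) +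
    6 * (Real.log (Real.log n) * Real.exp (-Real.log (Real.log n)))

theorem tendsto_survBound : Tendsto survBound atTop (𝓝 0) := by
  have h1 : Tendsto (fun L : ℝ => Real.exp (1 - L)) atTop (𝓝 0) :=
    Real.tendsto_exp_atBot.comp (tendsto_const_nhds.add_atBot tendsto_neg_atTop_atBot)
  have h2 := (Real.tendsto_pow_mul_exp_neg_atTop_nhds_zero 1).const_mul 6
  simp only [pow_one, mul_zero] at h2
  have h3 := (h1.add h2).comp tendsto_log_log_nat
  rw [add_zero] at h3
  exact h3

theorem eventually_cube_le :
    ∀ᶠ L : ℝ in atTop, L ^ 3 / 2 ≤ 2 * Real.exp (-3) / 9 / 4 * Real.exp (Real.exp L / 4) := by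
  have hpos : 0 < 2 * Real.exp (-3) / 9 / 4 := by positivity
  filter_upwards [(Real.tendsto_pow_mul_exp_neg_atTop_nhds_zero 3).eventually_le_const hpos,
    eventually_ge_atTop (8 : ℝ)] with L h1 hL
  have h2 : L ≤ Real.exp L / 4 := by
    have := Real.quadratic_le_exp_of_nonneg (show 0 ≤ L by linarith)
    nlinarith
  have h3 : L ^ 3 ≤ 2 * Real.exp (-3) / 9 / 4 * Real.exp L := by
    rw [Real.exp_neg L, ← div_eq_mul_inv, div_le_iff₀ (Real.exp_pos _)] at h1
    exact h1
  have h4 : Real.exp L ≤ Real.exp (Real.exp L / 4) := Real.exp_le_exp.2 h2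
  have h5 : 0 ≤ L ^ 3 := by positivity
  calc L ^ 3 / 2 ≤ L ^ 3 := by linarith
    _ ≤ _ := h3.trans (by gcongr)

theorem eventually_survProb_le {δ : ℝ} {ρ : ℕ → ℝ} {T : ℕ → ℕ} (hδ : 0 < δ)
    (hρ : ∀ᶠ n : ℕ in atTop, δ < ρ n ∧
      ρ n < 1 - 4 * Real.log (Real.log n) ^ 3 / Real.log n)
    (hT : ∀ᶠ n : ℕ in atTop, Real.exp (4 * Real.log (Real.log n) ^ 2) ≤ (T n : ℝ)) :
    ∀ᶠ n : ℕ in atTop, n ≠ 0 ∧ 0 < ρ n ∧ ρ n < 1 ∧ ∀ x y : Cube n, x ≠ y →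
      survProb (ρ n) (T n - 1) (x, y) ≤ survBound n := by
  set c := Real.exp (-(((pushConst + 2) / √δ + 1) ^ 2 / 2)) / 3 *
    (2 * Real.exp (-(1 / 2)) / 3) with hc
  have hc0 : 0 < c / 2 := by positivity
  filter_upwards [hρ, hT, tendsto_log_log_nat.eventually_ge_atTop 8,
    tendsto_log_log_nat.eventually_ge_atTop (2 * -Real.log (c / 2)),
    tendsto_log_log_nat.eventually eventually_cube_le,
    (Real.tendsto_log_atTop.comp tendsto_natCast_atTop_atTop).eventually_gt_atTop 0,
    eventually_ge_atTop 1] with n hρn hTn hL hLC hcube hlog hn1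
  have hlog : 0 < Real.log n := hlog
  set L := Real.log (Real.log n) with hLdef
  have hE : Real.exp L = Real.log n := Real.exp_log hlog
  have hnE : (n : ℝ) = Real.exp (Real.exp L) := by
    rw [hE, Real.exp_log (by exact_mod_cast hn1)]
  have hL3 : (8 : ℝ) ≤ L ^ 3 := by nlinarith [mul_nonneg (sq_nonneg L) (show 0 ≤ L - 8 by linarith)]
  have hgap : 4 * L ^ 3 / Real.exp L < 1 - ρ n := by
    rw [hE]; linarith [hρn.2]
  have hgap0 : 0 < 4 * L ^ 3 / Real.exp L := by positivity
  have hρ0 : 0 < ρ n := hδ.trans hρn.1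
  have hρ1 : ρ n < 1 := by linarith
  -- This is what the upper bound on ρ is for: 1 - ρ > 4L³/log n and ρ < 1.
  have hR : ρ n / (1 - ρ n) * L ^ 3 ≤ Real.exp L / 4 := by
    rw [div_lt_iff₀ (Real.exp_pos L)] at hgap
    rw [div_mul_eq_mul_div, div_le_iff₀ (by linarith)]
    nlinarith
  have hR1 : δ ≤ ρ n / (1 - ρ n) := by
    rw [le_div_iff₀ (by linarith)]
    nlinarith
  have hR2 : ρ n / (1 - ρ n) ≤ Real.exp L := by
    have : 0 ≤ ρ n / (1 - ρ n) := by linarith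
    nlinarith [Real.exp_pos L]
  have hq := le_pushProb hδ hR1 hR2 (Real.one_le_exp (by linarith))
  refine ⟨by omega, hρ0, hρ1, fun x y hxy => ?_⟩
  refine survProb_le_of_params hnE hL (C := -Real.log (c / 2)) (by linarith) hρ0 hρ1 hR ?_ hcube
    hTn hxy
  rw [neg_neg, Real.exp_log hc0, div_right_comm]
  gcongr

/-! ### The main theorem -/

theorem mem_noHit_of_lt_hitTime {n : ℕ} {ρ : ℝ} {T : ℕ} {Θ : ℕ → Layer n} {x y : Cube n}
    (h : (T : ℕ∞) < hitTime ρ (1 / 2) Θ x y) : Θ ∈ noHit ρ T x y := by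
  intro s hs
  by_contra hg
  have h1 : hitTime ρ (1 / 2) Θ x y ≤ ((s + 1 : ℕ) : ℕ∞) := 
    iInf_le_of_le s (iInf_le_of_le (not_lt.1 hg) le_rfl)
  have h2 : ((s + 1 : ℕ) : ℕ∞) ≤ T := by exact_mod_cast hs
  exact absurd (h.trans_le (h1.trans h2)) (lt_irrefl _)

/-- Equal inputs stay equal and are bounded trivially by 1; their probability is (1-ε)^n. -/
theorem integral_survProb_le {n : ℕ} {ρ ε a : ℝ} {m : ℕ} (h0 : 0 ≤ ε) (h1 : ε ≤ 1)
    (ha : ∀ x y : Cube n, x ≠ y → survProb ρ m (x, y) ≤ a) (ha0 : 0 ≤ a) :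
    ∫ p, survProb ρ m p ∂noisyPair n ε ≤ (1 - ε) ^ n + a := by
  have := isProbabilityMeasure_noisyPair n h0 h1
  have hd : MeasurableSet {p : Cube n × Cube n | p.1 = p.2} := (Set.toFinite _).measurableSet
  calc ∫ p, survProb ρ m p ∂noisyPair n ε
      ≤ ∫ p, ({p | p.1 = p.2}.indicator (fun _ => (1 : ℝ)) p + a) ∂noisyPair n ε := by
        refine integral_mono Integrable.of_finite Integrable.of_finite fun p => ?_
        by_cases hp : p.1 = p.2
        · rw [Set.indicator_of_mem (by exact hp)]
          linarith [survProb_le_one ρ m p]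
        · rw [Set.indicator_of_notMem (by exact hp), zero_add]
          exact ha p.1 p.2 hp
    _ = (1 - ε) ^ n + a := by
        rw [integral_add Integrable.of_finite Integrable.of_finite, integral_const, probReal_univ,
          one_smul, integral_indicator_const _ hd, noisyPair_real_diagonal h0 h1, smul_eq_mul,
          mul_one]

/-- Passing to the measurable event `noHit` avoids discussing the measurability of `hitTime`. -/
theorem prod_hitTime_gt_le {n : ℕ} {ρ ε : ℝ} (T : ℕ) (h0 : 0 ≤ ε) (h1 : ε ≤ 1) :
    ((networkLaw n).prod (noisyPair n ε))
        {x | (T : ℕ∞) < hitTime ρ (1 / 2) x.1 x.2.1 x.2.2} ≤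
      ENNReal.ofReal (∫ p, survProb ρ T p ∂noisyPair n ε) := by
  have := isProbabilityMeasure_noisyPair n h0 h1
  have hm : MeasurableSet {q : (ℕ → Layer n) × (Cube n × Cube n) |
      q.1 ∈ noHit ρ T q.2.1 q.2.2} := by
    have : Measurable fun q : (ℕ → Layer n) × (Cube n × Cube n) => q.1 ∈ noHit ρ T q.2.1 q.2.2 :=
      measurable_from_prod_countable_left fun p => (measurableSet_noHit ρ T p.1 p.2).mem
    exact measurableSet_setOfPred.2 this
  have hsub : {x : (ℕ → Layer n) × (Cube n × Cube n) |
      (T : ℕ∞) < hitTime ρ (1 / 2) x.1 x.2.1 x.2.2} ⊆ {q | q.1 ∈ noHit ρ T q.2.1 q.2.2} :=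
    fun q hq => mem_noHit_of_lt_hitTime hq
  refine (measure_mono hsub).trans ?_
  rw [Measure.prod_apply_symm hm, ofReal_integral_eq_lintegral_ofReal Integrable.of_finite
    (ae_of_all _ fun p => survProb_nonneg ρ T p)]
  refine lintegral_mono fun p => le_of_eq ?_
  rw [← networkLaw_real_noHit ρ T p.1 p.2, ofReal_measureReal]
  rfl

theorem noiseCorr_eq_covariance {n : ℕ} {ε : ℝ} (h0 : 0 ≤ ε) (h1 : ε ≤ 1) {f : BoolFun n}
    (hf : Function.Odd f) :
    covariance (fun x : Cube n × Cube n => signVal (f x.1)) (fun x => signVal (f x.2))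
      (noisyPair n ε) = noiseCorr ε f := by
  have := isProbabilityMeasure_noisyPair n h0 h1
  have hz : ∫ p : Cube n × Cube n, signVal (f p.1) ∂noisyPair n ε = 0 := by
    rw [← integral_signVal_of_odd hf, ← map_fst_noisyPair h0 h1,
      integral_map measurable_fst.aemeasurable (measurable_of_countable _).aestronglyMeasurable]
  rw [covariance_eq_sub MemLp.of_discrete MemLp.of_discrete, hz, zero_mul, sub_zero]
  rfl

theorem isProbabilityMeasure_networkFunLaw (n : ℕ) (ρ : ℝ) (T : ℕ) (h : BoolFun n) :
    IsProbabilityMeasure (networkFunLaw n ρ T h) :=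
  Measure.isProbabilityMeasure_map (measurable_network ρ T h).aemeasurable

theorem ae_odd_networkFunLaw {n : ℕ} {ρ : ℝ} (hρ : ρ < 1) (T : ℕ) {h : BoolFun n}
    (hh : Function.Odd h) : ∀ᵐ f ∂networkFunLaw n ρ T h, Function.Odd f :=
  (ae_map_iff (measurable_network ρ T h).aemeasurable (Set.toFinite _).measurableSet).2
    (ae_network_odd hρ T hh)

theorem integral_noiseCorr_networkFunLaw {n : ℕ} {ρ ε : ℝ} (T : ℕ) (h : BoolFun n) (h0 : 0 ≤ ε)
    (h1 : ε ≤ 1) : ∫ f, noiseCorr ε f ∂networkFunLaw n ρ T h =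
      ∫ p, outputCorr ρ h T p.1 p.2 ∂noisyPair n ε := by
  rw [networkFunLaw, integral_map (measurable_network ρ T h).aemeasurable
    (measurable_of_countable _).aestronglyMeasurable, integral_outputCorr_noisyPair ρ h T h0 h1]

theorem annealed_covariance_eq {n : ℕ} {ρ ε : ℝ} (hρ : ρ < 1) (T : ℕ) {h : BoolFun n}
    (hh : Function.Odd h) (h0 : 0 ≤ ε) (h1 : ε ≤ 1) :
    covariance (fun x : BoolFun n × (Cube n × Cube n) => signVal (x.1 x.2.1))
      (fun x => signVal (x.1 x.2.2)) ((networkFunLaw n ρ T h).prod (noisyPair n ε)) =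
      ∫ f, noiseCorr ε f ∂networkFunLaw n ρ T h := by
  have := isProbabilityMeasure_noisyPair n h0 h1
  have := isProbabilityMeasure_networkFunLaw n ρ T h
  have hz : ∫ x : BoolFun n × (Cube n × Cube n), signVal (x.1 x.2.1)
      ∂((networkFunLaw n ρ T h).prod (noisyPair n ε)) = 0 := by
    rw [integral_prod _ Integrable.of_finite]
    refine integral_eq_zero_of_ae ?_
    filter_upwards [ae_odd_networkFunLaw hρ T hh] with f hf
    have hz : ∫ p : Cube n × Cube n, signVal (f p.1) ∂noisyPair n ε = 0 := by
      rw [← integral_signVal_of_odd hf, ← map_fst_noisyPair h0 h1,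
        integral_map measurable_fst.aemeasurable (measurable_of_countable _).aestronglyMeasurable]
    exact hz
  rw [covariance_eq_sub MemLp.of_discrete MemLp.of_discrete, hz, zero_mul, sub_zero,
    integral_prod _ Integrable.of_finite]
  rfl

theorem mainTheorem4 :
    ∃ K : ℕ → ℕ,
      ∀ (δ : ℝ) (ε ρ : ℕ → ℝ) (T : ℕ → ℕ),
        0 < δ →
        (∀ n, ε n ≤ 1 / 2) → Antitone ε → Tendsto ε atTop (𝓝 0) →
        Tendsto (fun n : ℕ => (n : ℝ) * ε n) atTop atTop →
        (∀ᶠ n : ℕ in atTop, δ < ρ n ∧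
          ρ n < 1 - 4 * Real.log (Real.log n) ^ 3 / Real.log n) →
        (∀ᶠ n : ℕ in atTop, Real.exp (4 * Real.log (Real.log n) ^ 2) ≤ (T n : ℝ)) →
        Tendsto (fun n => ((networkLaw n).prod (noisyPair n (ε n)))
            {x | (T n : ℕ∞) < hitTime (ρ n) (1 / 2) x.1 x.2.1 x.2.2}) atTop (𝓝 0) ∧
        ∀ h : (n : ℕ) → BoolFun n, (∀ᶠ n : ℕ in atTop, Function.Odd (h n)) →
          (SharpThresholdAtHalf h →
            AnnealedQNS (fun n => networkFunLaw n (ρ n) (T n) (h n)) ε ∧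
            QuenchedQNS (fun n => networkFunLaw n (ρ n) (T n) (h n)) ε) ∧
          ((∀ᶠ n : ℕ in atTop, K n ≤ T n) →
            AnnealedQNS (fun n => networkFunLaw n (ρ n) (T n) (h n)) ε ∧
            QuenchedQNS (fun n => networkFunLaw n (ρ n) (T n) (h n)) ε) := by
  refine ⟨fun _ => 0, fun δ ε ρ T hδ hε hanti hε0 hnε hρ hT => ?_⟩
  -- A non-increasing sequence stays above its limit.
  have hεnn : ∀ n, 0 ≤ ε n := hanti.le_of_tendsto hε0
  have hε1 : ∀ n, ε n ≤ 1 := fun n => (hε n).trans (by norm_num)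
  have hev := eventually_survProb_le hδ hρ hT
  have hsb : ∀ᶠ n : ℕ in atTop, 0 ≤ survBound n := by
    filter_upwards [tendsto_log_log_nat.eventually_ge_atTop 0] with n hn
    unfold survBound
    positivity
  have hpow : Tendsto (fun n : ℕ => (1 - ε n) ^ n) atTop (𝓝 0) := by
    refine squeeze_zero (fun n => pow_nonneg (by linarith [hε1 n]) n) (fun n => ?_)
      (Real.tendsto_exp_atBot.comp (tendsto_neg_atTop_atBot.comp hnε))
    calc (1 - ε n) ^ n ≤ Real.exp (-ε n) ^ n := by
          gcongr
          · linarith [hε1 n]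
          · exact Real.one_sub_le_exp_neg _
      _ = Real.exp (-((n : ℝ) * ε n)) := by rw [← Real.exp_nat_mul]; congr 1; ring
  have hlim : Tendsto (fun n => (1 - ε n) ^ n + survBound n) atTop (𝓝 0) := by
    simpa using hpow.add tendsto_survBound
  have hsurv : ∀ᶠ n in atTop, ∫ p, survProb (ρ n) (T n - 1) p ∂noisyPair n (ε n) ≤
      (1 - ε n) ^ n + survBound n := by
    filter_upwards [hev, hsb] with n hn hn'
    exact integral_survProb_le (hεnn n) (hε1 n) hn.2.2.2 hn'
  refine ⟨?_, fun h hodd => ?_⟩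
  · have hlim' := ENNReal.tendsto_ofReal hlim
    rw [ENNReal.ofReal_zero] at hlim'
    refine tendsto_of_tendsto_of_tendsto_of_le_of_le' tendsto_const_nhds hlim'
      (Eventually.of_forall fun _ => zero_le) ?_
    filter_upwards [hsurv] with n hn
    have := isProbabilityMeasure_noisyPair n (hεnn n) (hε1 n)
    refine (prod_hitTime_gt_le (T n) (hεnn n) (hε1 n)).trans (ENNReal.ofReal_le_ofReal ?_)
    exact (integral_mono Integrable.of_finite Integrable.of_finite fun p =>
      survProb_antitone (ρ n) p (Nat.sub_le _ _)).trans hn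
  · -- The noise operator is positive for `ε ≤ 1 / 2`, and for odd functions the correlation after
    -- the hitting time is nonpositive by symmetry. This bounds the covariance by the survival
    -- probability for every odd `h` and every depth, so both parts hold already with `K = 0`.
    suffices hmain : AnnealedQNS (fun n => networkFunLaw n (ρ n) (T n) (h n)) ε ∧
        QuenchedQNS (fun n => networkFunLaw n (ρ n) (T n) (h n)) ε from
      ⟨fun _ => hmain, fun _ => hmain⟩
    have hTpos : ∀ᶠ n in atTop, 1 ≤ T n := by
      filter_upwards [hT] with n hn
      have : (0 : ℝ) < T n := (Real.exp_pos _).trans_le hn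
      exact_mod_cast this
    have hI0 : ∀ n, 0 ≤ ∫ f, noiseCorr (ε n) f ∂networkFunLaw n (ρ n) (T n) (h n) := fun n =>
      integral_nonneg fun f => noiseCorr_nonneg (hεnn n) (hε n) f
    have hI : Tendsto (fun n => ∫ f, noiseCorr (ε n) f ∂networkFunLaw n (ρ n) (T n) (h n))
        atTop (𝓝 0) := by
      refine tendsto_of_tendsto_of_tendsto_of_le_of_le' tendsto_const_nhds hlim
        (Eventually.of_forall hI0) ?_
      filter_upwards [hev, hsurv, hodd, hTpos] with n hn hs ho hTn
      have := isProbabilityMeasure_noisyPair n (hεnn n) (hε1 n)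
      rw [integral_noiseCorr_networkFunLaw (T n) (h n) (hεnn n) (hε1 n)]
      refine le_trans (integral_mono Integrable.of_finite Integrable.of_finite fun p => ?_) hs
      have := outputCorr_succ_le_survProb hn.1 hn.2.1.le hn.2.2.1 ho (T n - 1) p.1 p.2
      rwa [Nat.sub_add_cancel hTn] at this
    constructor
    · refine hI.congr' ?_
      filter_upwards [hev, hodd] with n hn ho
      exact (annealed_covariance_eq hn.2.2.1 (T n) ho (hεnn n) (hε1 n)).symm
    · intro d hd
      rw [← eventually_atTop]
      -- The level d² is chosen so that Markov's inequality at threshold d leaves probability at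
      -- most d.
      filter_upwards [hev, hodd, hI.eventually_le_const (show 0 < d * d by positivity)]
        with n hn ho hIn
      have := isProbabilityMeasure_networkFunLaw n (ρ n) (T n) (h n)
      have hmarkov := (mul_meas_ge_le_integral_of_nonneg
        (μ := networkFunLaw n (ρ n) (T n) (h n)) (f := noiseCorr (ε n))
        (ae_of_all _ fun f => noiseCorr_nonneg (hεnn n) (hε n) f) Integrable.of_finite d).trans hIn
      have hle := le_of_mul_le_mul_left hmarkov hd
      have hset : {f | covariance (fun x : Cube n × Cube n => signVal (f x.1))
          (fun x => signVal (f x.2)) (noisyPair n (ε n)) ≤ d} =ᵐ[networkFunLaw n (ρ n) (T n) (h n)]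
          {f | noiseCorr (ε n) f ≤ d} := by
        filter_upwards [ae_odd_networkFunLaw hn.2.2.1 (T n) ho] with f hf
        have := noiseCorr_eq_covariance (hεnn n) (hε1 n) hf
        exact propext (by
          change _ ≤ d ↔ _ ≤ d
          rw [this])
      rw [measureReal_congr hset]
      have hc : {f : BoolFun n | d ≤ noiseCorr (ε n) f}ᶜ ⊆ {f | noiseCorr (ε n) f ≤ d} :=
        fun f hf => (not_le.1 (show ¬d ≤ noiseCorr (ε n) f from hf)).le
      refine le_trans ?_ (measureReal_mono hc)
      rw [probReal_compl_eq_one_sub (Set.toFinite _).measurableSet]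
      linarith

end
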